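/- **Theorem.** An instance of the parameterized problem $l$-MaxCDDP consists of a finite undirected graph $G=(V,E)$ with $n=|V|$ vertices, a finite set $C$ of $q=|C|$ colors, a coloring $f_C:E\to 2^{C}$ that assigns a set of colors to each edge, two distinct vertices $s,t\in V$, and integers $l\ge 1$ and $k\ge 1$. A path is simple; an $st$-path is *colored by* $c\in C$ if $c\in f_C(e)$ for each of its edges $e$, and its length is its number of edges. The question is whether there is a set of at least $k$ (distinct) $st$-paths, each of length at most $l$, such that one can choose for each path of the set a color by which it is colored, in such a way that any two different paths of the set have no vertex in common except $s$ and $t$ and have different chosen colors. There is a (single, deterministic) algorithm that decides this problem on all instances, with $l$ and $k$ part of the input, in time $$2^{O(lk)}\cdot \mathrm{poly}(n+q),$$ that is, in at most $2^{c\,l k}\cdot f(n+q)$ steps for some constant $c$ and some polynomial $f$ that do not depend on the instance. Here the algorithm is a program for a random access machine with natural-number registers and memory cells, indirect addressing, branching and loops, and unit cost for each memory access and each operation among addition, truncated subtraction, integer division and remainder (no multiplication). The input is given in memory as the list $n,q,s,t,l,k$ followed by the adjacency matrix of $G$ and, for each pair of vertices, the $0/1$ indicator vector of the color set of the corresponding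 edge. -/

import Mathlib

/-! ## Random access machines with unit cost -/

namespace RAM

/-- Arithmetic expressions over registers and memory. Subtraction is truncated at `0`, `div` is the
integer quotient and `mod` the remainder. There is no multiplication, so a computation of `T` steps
lengthens the binary representation of numbers by at most `T` bits (up to a constant depending on
the program), and unit cost is polynomially related to the running time of a Turing machine. -/
inductive Expr : Type
  | const (a : ℕ)
  | reg (i : ℕ)
  | load (addr : Expr)
  | add (x y : Expr)
  | sub (x y : Expr)
  | div (x y : Expr)
  | mod (x y : Expr)

/-- Programs. A condition `e` counts as true when its value is nonzero. -/
inductive Prog : Type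
  | skip
  | assign (i : ℕ) (e : Expr)
  | store (addr e : Expr)
  | seq (p q : Prog)
  | branch (e : Expr) (p q : Prog)
  | loop (e : Expr) (p : Prog)

/-- The contents of the registers and of the memory cells. -/
@[ext]
structure State : Type where
  reg : ℕ → ℕ
  mem : ℕ → ℕ

/-- The value of an expression. -/
def Expr.eval (σ : State) : Expr → ℕ
  | const a => a
  | reg i => σ.reg i
  | load x => σ.mem (x.eval σ)
  | add x y => x.eval σ + y.eval σ
  | sub x y => x.eval σ - y.eval σ
  | div x y => x.eval σ / y.eval σ
  | mod x y => x.eval σ % y.eval σ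

/-- The cost of evaluating an expression: one unit for each constant, register access, memory access
and arithmetic operation in it. -/
def Expr.cost : Expr → ℕ
  | const _ => 1
  | reg _ => 1
  | load x => x.cost + 1
  | add x y => x.cost + y.cost + 1
  | sub x y => x.cost + y.cost + 1
  | div x y => x.cost + y.cost + 1
  | mod x y => x.cost + y.cost + 1

/-- `Run p σ σ' T`: the program `p`, started in `σ`, halts in `σ'` after exactly `T` steps. -/
inductive Run : Prog → State → State → ℕ → Prop
  | skip (σ : State) : Run .skip σ σ 1
  | assign (σ : State) (i : ℕ) (e : Expr) :
      Run (.assign i e) σ { σ with reg := Function.update σ.reg i (e.eval σ) } (e.cost + 1)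
  | store (σ : State) (a e : Expr) :
      Run (.store a e) σ { σ with mem := Function.update σ.mem (a.eval σ) (e.eval σ) }
        (a.cost + e.cost + 1)
  | seq {p q : Prog} {σ₁ σ₂ σ₃ : State} {T₁ T₂ : ℕ} :
      Run p σ₁ σ₂ T₁ → Run q σ₂ σ₃ T₂ → Run (.seq p q) σ₁ σ₃ (T₁ + T₂)
  | branch_true {e : Expr} {p q : Prog} {σ σ' : State} {T : ℕ} :
      e.eval σ ≠ 0 → Run p σ σ' T → Run (.branch e p q) σ σ' (e.cost + 1 + T)
  | branch_false {e : Expr} {p q : Prog} {σ σ' : State} {T : ℕ} :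
      e.eval σ = 0 → Run q σ σ' T → Run (.branch e p q) σ σ' (e.cost + 1 + T)
  | loop_exit {e : Expr} {p : Prog} {σ : State} :
      e.eval σ = 0 → Run (.loop e p) σ σ (e.cost + 1)
  | loop_step {e : Expr} {p : Prog} {σ₁ σ₂ σ₃ : State} {T₁ T₂ : ℕ} :
      e.eval σ₁ ≠ 0 → Run p σ₁ σ₂ T₁ → Run (.loop e p) σ₂ σ₃ T₂ →
      Run (.loop e p) σ₁ σ₃ (e.cost + 1 + T₁ + T₂)

/-- The machine is deterministic: final state and number of steps are determined by program and
initial state. -/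
theorem Run.deterministic {p : Prog} {σ σ' : State} {T : ℕ} (h : Run p σ σ' T) :
    ∀ {σ'' : State} {T' : ℕ}, Run p σ σ'' T' → σ' = σ'' ∧ T = T' := by
  induction h with
  | skip => intro _ _ h; cases h; exact ⟨rfl, rfl⟩
  | assign => intro _ _ h; cases h; exact ⟨rfl, rfl⟩
  | store => intro _ _ h; cases h; exact ⟨rfl, rfl⟩
  | seq _ _ ih₁ ih₂ =>
    intro _ _ h
    cases h with
    | seq a b =>
      obtain ⟨rfl, rfl⟩ := ih₁ a
      obtain ⟨rfl, rfl⟩ := ih₂ b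
      exact ⟨rfl, rfl⟩
  | branch_true he _ ih =>
    intro _ _ h
    cases h with
    | branch_true _ a => obtain ⟨rfl, rfl⟩ := ih a; exact ⟨rfl, rfl⟩
    | branch_false he' _ => exact absurd he' he
  | branch_false he _ ih =>
    intro _ _ h
    cases h with
    | branch_true he' _ => exact absurd he he'
    | branch_false _ a => obtain ⟨rfl, rfl⟩ := ih a; exact ⟨rfl, rfl⟩
  | loop_exit he =>
    intro _ _ h
    cases h with
    | loop_exit _ => exact ⟨rfl, rfl⟩
    | loop_step he' _ _ => exact absurd he he'
  | loop_step he _ _ ih₁ ih₂ =>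
    intro _ _ h
    cases h with
    | loop_exit he' => exact absurd he' he
    | loop_step _ a b =>
      obtain ⟨rfl, rfl⟩ := ih₁ a
      obtain ⟨rfl, rfl⟩ := ih₂ b
      exact ⟨rfl, rfl⟩

/-- Initially the input occupies the first memory cells; everything else is `0`. -/
def State.init (input : List ℕ) : State where
  reg _ := 0
  mem i := input.getD i 0

/-- On the given input, the program `p` halts after exactly `T` steps with `out` in register `0`. -/
def Prog.Outputs (p : Prog) (input : List ℕ) (out T : ℕ) : Prop :=
  ∃ σ : State, Run p (State.init input) σ T ∧ σ.reg 0 = out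

end RAM

/-! ## Edge-colored graphs and color disjoint paths -/

/-- An undirected graph on `V` with a set of colors from `C` on each edge. -/
structure EdgeColoredGraph (V C : Type) where
  graph : SimpleGraph V
  coloring : graph.edgeSet → Finset C

namespace EdgeColoredGraph

variable {V C : Type} (G : EdgeColoredGraph V C)

/-- The edge `uv` exists and is colored by `c`. -/
def EdgeHasColor (u v : V) (c : C) : Prop :=
  ∃ h : s(u, v) ∈ G.graph.edgeSet, c ∈ G.coloring ⟨s(u, v), h⟩

/-- All the edges of the path `p` are colored by `c`. -/
def ColoredBy {x y : V} (p : G.graph.Path x y) (c : C) : Prop :=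
  ∀ (e : Sym2 V) (he : e ∈ p.1.edges), c ∈ G.coloring ⟨e, p.1.edges_subset_edgeSet he⟩

/-- The two `xy`-paths share no vertex other than `x` and `y`. -/
def InternallyDisjoint {x y : V} (p p' : G.graph.Path x y) : Prop :=
  ∀ v : V, v ∈ p.1.support → v ∈ p'.1.support → v = x ∨ v = y

/-- `P` is a set of color disjoint uni-color `xy`-paths: each path of `P` can be given a color by
which all of its edges are colored, so that any two different paths of `P` are internally
disjoint and have different colors. -/
def ColorDisjoint {x y : V} (P : Finset (G.graph.Path x y)) : Prop :=
  ∃ χ : G.graph.Path x y → C,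
    (∀ p ∈ P, G.ColoredBy p (χ p)) ∧
    ∀ p ∈ P, ∀ p' ∈ P, p ≠ p' → G.InternallyDisjoint p p' ∧ χ p ≠ χ p'

end EdgeColoredGraph

/-! ## The parameterized problem -/

/-- Instances: an edge-colored graph with `n` vertices and `q` colors, two distinct terminals,
the bound `l` on the length of the paths and the required number `k` of paths. -/
structure LMaxCDDP : Type where
  n : ℕ
  q : ℕ
  G : EdgeColoredGraph (Fin n) (Fin q)
  s : Fin n
  t : Fin n
  s_ne_t : s ≠ t
  l : ℕ
  one_le_l : 1 ≤ l
  k : ℕ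
  k_pos : 0 < k

namespace LMaxCDDP

variable (I : LMaxCDDP)

/-- There are at least `k` color disjoint uni-color `st`-paths with at most `l` edges each. -/
def IsYes : Prop :=
  ∃ P : Finset (I.G.graph.Path I.s I.t),
    I.k ≤ P.card ∧ (∀ p ∈ P, p.1.length ≤ I.l) ∧ I.G.ColorDisjoint P

open Classical in
/-- The correct output: `1` on yes-instances and `0` on no-instances. -/
noncomputable def answer : ℕ := if I.IsYes then 1 else 0

open Classical in
/-- The adjacency matrix, row by row. -/
noncomputable def adjacencyList : List ℕ :=
  List.ofFn fun i : Fin (I.n * I.n) =>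
    if I.G.graph.Adj (finProdFinEquiv.symm i).1 (finProdFinEquiv.symm i).2 then 1 else 0

open Classical in
/-- For the vertex pairs `(u, v)` in the same order, the indicator vector of the set of colors of
the edge `uv` (zero if `uv` is not an edge): the entry for `u`, `v`, `c` has index
`(u * n + v) * q + c`. -/
noncomputable def colorList : List ℕ :=
  List.ofFn fun i : Fin (I.n * I.n * I.q) =>
    if I.G.EdgeHasColor
        (finProdFinEquiv.symm (finProdFinEquiv.symm i).1).1
        (finProdFinEquiv.symm (finProdFinEquiv.symm i).1).2
        (finProdFinEquiv.symm i).2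
    then 1 else 0

/-- The input given to the machine. -/
noncomputable def encode : List ℕ :=
  [I.n, I.q, (I.s : ℕ), (I.t : ℕ), I.l, I.k] ++ I.adjacencyList ++ I.colorList

end LMaxCDDP

/-! Put `L = k * (l + 1)`. A choice of `k` paths, traversed one after the other, is a run of `L`
transitions of an automaton on pairs (vertex, color): a jump from `t` to `s` that picks a color,
then `l` transitions along edges of that color, waiting at `t` once the path is over. The labels of
the transitions are designed so that the instance is solvable exactly when some run has `L` distinct
labels (`LMaxCDDP.isYes_iff_exists_run`).

Distinctness is detected algebraically and without randomness. The Vandermonde determinant of the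
labels is nonzero exactly when they are distinct, and its square is never negative, so the sum of
the squares over all runs cannot cancel: it is positive if and only if a run with distinct labels
exists (`LabeledAutomaton.runSum_pos`). Expanding both factors of the square along the row of the
last label leaves minors that depend only on the sets of exponents not yet used. The sum therefore
obeys a recursion on the number of transitions, two subsets of the `L` exponents, a vertex and a
color. Terms of even and of odd sign are added up separately, as the machine has no negative numbers
(`LabeledAutomaton.signedCount_sub`).

The resulting table has about `4 ^ L` entries, up to factors polynomial in `n`, `q` and `L`. As `L ≤
2 * l * k`, all is polynomial in `bound = n + q + 2 ^ (4 * l * k)`. The class `Cmp` of functions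
computable in polynomial time is closed under arithmetic and bounded recursion, so the formula for
one entry yields a program, and `LMaxCDDP.exists_program` puts one loop around it. Finally, a
polynomial in `bound` is at most `2 ^ O(l * k)` times a polynomial in `n + q`. -/

namespace RAM

/-! ### Total correctness with time bounds -/

/-- Started in `σ`, the program `p` halts within `B` steps in a state satisfying `Q`. -/
def Exec (p : Prog) (σ : State) (Q : State → Prop) (B : ℕ) : Prop :=
  ∃ σ' T, Run p σ σ' T ∧ Q σ' ∧ T ≤ B

theorem Exec.mono {p : Prog} {σ : State} {Q Q' : State → Prop} {B B' : ℕ} (h : Exec p σ Q B)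
    (hQ : ∀ σ', Q σ' → Q' σ') (hB : B ≤ B') : Exec p σ Q' B' := by
  obtain ⟨σ', T, r, q, t⟩ := h
  exact ⟨σ', T, r, hQ _ q, t.trans hB⟩

theorem Exec.seq {p q : Prog} {σ : State} {Q R : State → Prop} {B₁ B₂ : ℕ} (h : Exec p σ Q B₁)
    (h' : ∀ σ', Q σ' → Exec q σ' R B₂) : Exec (.seq p q) σ R (B₁ + B₂) := by
  obtain ⟨σ', T, r, hq, t⟩ := h
  obtain ⟨σ'', T', r', hq', t'⟩ := h' _ hq
  exact ⟨σ'', _, .seq r r', hq', Nat.add_le_add t t'⟩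

theorem Exec.assign {σ : State} {Q : State → Prop} {i : ℕ} {e : Expr}
    (h : Q { σ with reg := Function.update σ.reg i (e.eval σ) }) :
    Exec (.assign i e) σ Q (e.cost + 1) :=
  ⟨_, _, .assign σ i e, h, le_rfl⟩

theorem Exec.store {σ : State} {Q : State → Prop} {a e : Expr}
    (h : Q { σ with mem := Function.update σ.mem (a.eval σ) (e.eval σ) }) :
    Exec (.store a e) σ Q (a.cost + e.cost + 1) :=
  ⟨_, _, .store σ a e, h, le_rfl⟩

theorem Exec.branch {σ : State} {Q : State → Prop} {e : Expr} {p q : Prog} {B : ℕ}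
    (hp : e.eval σ ≠ 0 → Exec p σ Q B) (hq : e.eval σ = 0 → Exec q σ Q B) :
    Exec (.branch e p q) σ Q (e.cost + 1 + B) := by
  by_cases he : e.eval σ = 0
  · obtain ⟨σ', T, r, hQ, t⟩ := hq he
    exact ⟨σ', _, .branch_false he r, hQ, Nat.add_le_add le_rfl t⟩
  · obtain ⟨σ', T, r, hQ, t⟩ := hp he
    exact ⟨σ', _, .branch_true he r, hQ, Nat.add_le_add le_rfl t⟩

/-- A loop with an invariant indexed by the number of completed rounds. -/
theorem Exec.loop {e : Expr} {p : Prog} (Inv : ℕ → State → Prop) {N B : ℕ}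
    (hstep : ∀ i < N, ∀ σ, Inv i σ → e.eval σ ≠ 0 ∧ Exec p σ (Inv (i + 1)) B)
    (hexit : ∀ σ, Inv N σ → e.eval σ = 0) {σ : State} (h0 : Inv 0 σ) :
    Exec (.loop e p) σ (Inv N) (N * (e.cost + 1 + B) + (e.cost + 1)) := by
  suffices H : ∀ m i σ, i + m = N → Inv i σ →
      Exec (.loop e p) σ (Inv N) (m * (e.cost + 1 + B) + (e.cost + 1)) from H N 0 σ (by simp) h0
  intro m
  induction m with
  | zero =>
    intro i σ hi h
    obtain rfl : i = N := by simpa using hi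
    exact ⟨σ, _, .loop_exit (hexit σ h), h, by simp⟩
  | succ m ih =>
    intro i σ hi h
    obtain ⟨hne, σ', T, r, h', t⟩ := hstep i (by omega) σ h
    obtain ⟨σ'', T', r', h'', t'⟩ := ih (i + 1) σ' (by omega) h'
    exact ⟨σ'', _, .loop_step hne r r', h'', by rw [Nat.succ_mul]; omega⟩

/-! ### Functions computable in time polynomial in a given quantity -/

/-- A family, indexed by `X`, of situations in which a program can be started: the contents of the
memory, the values of `arity` variables that are kept in registers, and the quantity in terms of
which running times are measured. -/
structure Ctx (X : Type) where
  arity : ℕ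
  Valid : X → Prop
  val : ℕ → X → ℕ
  mem : X → ℕ → ℕ
  cap : X → ℕ

variable {X : Type}

/-- The state `σ` represents the situation `x`, with variable `i` in register `loc i`. -/
structure Ctx.Rep (Γ : Ctx X) (loc : ℕ → ℕ) (x : X) (σ : State) : Prop where
  valid : Γ.Valid x
  mem : σ.mem = Γ.mem x
  reg : ∀ i < Γ.arity, σ.reg (loc i) = Γ.val i x

/-- One more variable, with the restriction `W`. -/
def Ctx.ext (Γ : Ctx X) (W : X → ℕ → Prop) : Ctx (X × ℕ) where
  arity := Γ.arity + 1
  Valid y := Γ.Valid y.1 ∧ W y.1 y.2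
  val j y := if j < Γ.arity then Γ.val j y.1 else y.2
  mem y := Γ.mem y.1
  cap y := Γ.cap y.1

/-- The state after the value `r` has been computed into register `e`. -/
structure Result (e : ℕ) (σ : State) (r : ℕ) (σ' : State) : Prop where
  mem : σ'.mem = σ.mem
  reg : ∀ i < e, σ'.reg i = σ.reg i
  out : σ'.reg e = r

/-- The function `f` can be computed in time polynomial in `Γ.cap`, for any placement of the
variables in the registers below `e`, into register `e` and without changing the registers
below `e`. -/
def Cmp (Γ : Ctx X) (f : X → ℕ) : Prop :=
  ∀ (loc : ℕ → ℕ) (e : ℕ), (∀ i < Γ.arity, loc i < e) →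
    ∃ (p : Prog) (g : Polynomial ℕ), ∀ x σ, Γ.Rep loc x σ →
      Exec p σ (Result e σ (f x)) (g.eval (Γ.cap x))

theorem Ctx.Rep.of_result {Γ : Ctx X} {loc : ℕ → ℕ} {x : X} {σ σ' : State} {e r : ℕ}
    (h : Γ.Rep loc x σ) (hloc : ∀ i < Γ.arity, loc i < e) (hr : Result e σ r σ') :
    Γ.Rep loc x σ' :=
  ⟨h.valid, hr.mem.trans h.mem, fun i hi => (hr.reg _ (hloc i hi)).trans (h.reg i hi)⟩

theorem Cmp.congr {Γ : Ctx X} {f g : X → ℕ} (hf : Cmp Γ f) (h : ∀ x, Γ.Valid x → f x = g x) :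
    Cmp Γ g := by
  intro loc e hloc
  obtain ⟨p, P, hp⟩ := hf loc e hloc
  exact ⟨p, P, fun x σ hx => h x hx.valid ▸ hp x σ hx⟩

theorem Cmp.weaken {Γ : Ctx X} {f : X → ℕ} (hf : Cmp Γ f) (W : X → ℕ → Prop) :
    Cmp (Γ.ext W) (fun y => f y.1) := by
  intro loc e hloc
  obtain ⟨p, g, hp⟩ := hf loc e fun i hi => hloc i (Nat.lt_succ_of_lt hi)
  refine ⟨p, g, fun x σ hx => hp x.1 σ ⟨hx.valid.1, hx.mem, fun i hi => ?_⟩⟩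
  rw [hx.reg i (Nat.lt_succ_of_lt hi)]
  simp [Ctx.ext, hi]

theorem Cmp.expr {Γ : Ctx X} {f : X → ℕ}
    (h : ∀ loc : ℕ → ℕ, ∃ a : Expr, ∀ x σ, Γ.Rep loc x σ → a.eval σ = f x) : Cmp Γ f := by
  intro loc e _
  obtain ⟨a, ha⟩ := h loc
  refine ⟨.assign e a, Polynomial.C (a.cost + 1), fun x σ hx => ?_⟩
  rw [Polynomial.eval_C]
  refine Exec.assign ⟨rfl, fun i hi => ?_, ?_⟩
  · simp [hi.ne]
  · simp [ha x σ hx]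

theorem Cmp.const (Γ : Ctx X) (a : ℕ) : Cmp Γ (fun _ => a) :=
  Cmp.expr fun _ => ⟨.const a, fun _ _ _ => rfl⟩

theorem Cmp.var (Γ : Ctx X) {i : ℕ} (hi : i < Γ.arity) : Cmp Γ (Γ.val i) :=
  Cmp.expr fun loc => ⟨.reg (loc i), fun _ _ h => h.reg i hi⟩

theorem Cmp.last (Γ : Ctx X) (W : X → ℕ → Prop) : Cmp (Γ.ext W) (fun y => y.2) :=
  (Cmp.var (Γ.ext W) (i := Γ.arity) (Nat.lt_succ_self _)).congr fun x _ => by simp [Ctx.ext]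

theorem Cmp.unary {Γ : Ctx X} {f f' : X → ℕ} (hf : Cmp Γ f) (op : Expr → Expr)
    (hop : ∀ x σ i, σ.mem = Γ.mem x → σ.reg i = f x → (op (.reg i)).eval σ = f' x) :
    Cmp Γ f' := by
  intro loc e hloc
  obtain ⟨p, P, hp⟩ := hf loc e hloc
  refine ⟨.seq p (.assign e (op (.reg e))), P + Polynomial.C ((op (.reg e)).cost + 1),
    fun x σ hx => ?_⟩
  rw [Polynomial.eval_add, Polynomial.eval_C]
  refine (hp x σ hx).seq fun σ₁ h₁ => Exec.assign ⟨h₁.mem, fun i hi => ?_, ?_⟩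
  · simp [hi.ne, h₁.reg i hi]
  · simpa using hop x σ₁ e (h₁.mem.trans hx.mem) h₁.out

theorem Cmp.binary {Γ : Ctx X} {f₁ f₂ f' : X → ℕ} (h₁ : Cmp Γ f₁) (h₂ : Cmp Γ f₂)
    (op : Expr → Expr → Expr)
    (hop : ∀ x σ i j, σ.reg i = f₁ x → σ.reg j = f₂ x →
      (op (.reg i) (.reg j)).eval σ = f' x) :
    Cmp Γ f' := by
  intro loc e hloc
  obtain ⟨p, P, hp⟩ := h₁ loc e hloc
  obtain ⟨q, Q, hq⟩ := h₂ loc (e + 1) fun i hi => (hloc i hi).trans (Nat.lt_succ_self e)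
  refine ⟨.seq p (.seq q (.assign e (op (.reg e) (.reg (e + 1))))),
    P + (Q + Polynomial.C ((op (.reg e) (.reg (e + 1))).cost + 1)), fun x σ hx => ?_⟩
  simp only [Polynomial.eval_add, Polynomial.eval_C]
  refine (hp x σ hx).seq fun σ₁ r₁ => (hq x σ₁ (hx.of_result hloc r₁)).seq fun σ₂ r₂ =>
    Exec.assign ⟨r₂.mem.trans r₁.mem, fun i hi => ?_, ?_⟩
  · simp [hi.ne, r₂.reg i (by omega), r₁.reg i hi]
  · simpa using hop x σ₂ e (e + 1) ((r₂.reg e (by omega)).trans r₁.out) r₂.out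

theorem Cmp.load {Γ : Ctx X} {f : X → ℕ} (hf : Cmp Γ f) : Cmp Γ (fun x => Γ.mem x (f x)) :=
  hf.unary .load fun x σ i hm hr => by simp [Expr.eval, hm, hr]

theorem Cmp.add {Γ : Ctx X} {f g : X → ℕ} (hf : Cmp Γ f) (hg : Cmp Γ g) :
    Cmp Γ (fun x => f x + g x) :=
  hf.binary hg .add fun x σ i j h₁ h₂ => by simp [Expr.eval, h₁, h₂]

theorem Cmp.sub {Γ : Ctx X} {f g : X → ℕ} (hf : Cmp Γ f) (hg : Cmp Γ g) :
    Cmp Γ (fun x => f x - g x) :=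
  hf.binary hg .sub fun x σ i j h₁ h₂ => by simp [Expr.eval, h₁, h₂]

theorem Cmp.div {Γ : Ctx X} {f g : X → ℕ} (hf : Cmp Γ f) (hg : Cmp Γ g) :
    Cmp Γ (fun x => f x / g x) :=
  hf.binary hg .div fun x σ i j h₁ h₂ => by simp [Expr.eval, h₁, h₂]

theorem Cmp.mod {Γ : Ctx X} {f g : X → ℕ} (hf : Cmp Γ f) (hg : Cmp Γ g) :
    Cmp Γ (fun x => f x % g x) :=
  hf.binary hg .mod fun x σ i j h₁ h₂ => by simp [Expr.eval, h₁, h₂]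

theorem Cmp.cond {Γ : Ctx X} {b f g : X → ℕ} (hb : Cmp Γ b) (hf : Cmp Γ f) (hg : Cmp Γ g) :
    Cmp Γ (fun x => if b x ≠ 0 then f x else g x) := by
  intro loc e hloc
  obtain ⟨p, P, hp⟩ := hb loc e hloc
  obtain ⟨q, Q, hq⟩ := hf loc e hloc
  obtain ⟨r, R, hr⟩ := hg loc e hloc
  refine ⟨.seq p (.branch (.reg e) q r), P + (Polynomial.C 2 + (Q + R)), fun x σ hx => ?_⟩
  simp only [Polynomial.eval_add, Polynomial.eval_C]
  refine (hp x σ hx).seq fun σ₁ r₁ => Exec.branch (fun h => ?_) (fun h => ?_)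
  · have h' : b x ≠ 0 := by simpa [Expr.eval, r₁.out] using h
    refine (hq x σ₁ (hx.of_result hloc r₁)).mono (fun σ₂ r₂ => ?_) (Nat.le_add_right _ _)
    exact ⟨r₂.mem.trans r₁.mem, fun i hi => (r₂.reg i hi).trans (r₁.reg i hi),
      by rw [r₂.out, if_pos h']⟩
  · have h' : b x = 0 := by simpa [Expr.eval, r₁.out] using h
    refine (hr x σ₁ (hx.of_result hloc r₁)).mono (fun σ₂ r₂ => ?_) (Nat.le_add_left _ _)
    exact ⟨r₂.mem.trans r₁.mem, fun i hi => (r₂.reg i hi).trans (r₁.reg i hi),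
      by rw [r₂.out, if_neg (not_not.2 h')]⟩

/-- Primitive recursion with a bounded number of rounds. -/
theorem Cmp.rec {Γ : Ctx X} {f g : X → ℕ} {h : (X × ℕ) × ℕ → ℕ} (hf : Cmp Γ f)
    (hcap : ∀ x, Γ.Valid x → f x ≤ Γ.cap x) (hg : Cmp Γ g)
    (hh : Cmp ((Γ.ext fun x i => i < f x).ext fun _ _ => True) h) :
    Cmp Γ (fun x => Nat.rec (g x) (fun i acc => h ((x, i), acc)) (f x)) := by
  intro loc e hloc
  obtain ⟨p, P, hp⟩ := hf loc (e + 2) fun i hi => (hloc i hi).trans (by omega)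
  obtain ⟨q, Q, hq⟩ := hg loc (e + 3) fun i hi => (hloc i hi).trans (by omega)
  -- Register `e` is the counter, `e + 1` the accumulator and `e + 2` the number of rounds; the body
  -- works from `e + 3` on.
  let loc' : ℕ → ℕ := fun i =>
    if i < Γ.arity then loc i else if i = Γ.arity then e else e + 1
  obtain ⟨b, B, hb⟩ := hh loc' (e + 3) fun i _ => by
    simp only [loc']
    split_ifs with h₁
    · exact (hloc i h₁).trans (by omega)
    · omega
    · omega
  refine ⟨.seq p (.seq q (.seq (.assign (e + 1) (.reg (e + 3))) (.seq (.assign e (.const 0)) (.seq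
    (.loop (.sub (.reg (e + 2)) (.reg e)) (.seq b (.seq (.assign (e + 1) (.reg (e + 3)))
      (.assign e (.add (.reg e) (.const 1)))))) (.assign e (.reg (e + 1))))))),
    P + (Q + (Polynomial.C 2 + (Polynomial.C 2 +
      ((Polynomial.X * (Polynomial.C 4 + (B + (Polynomial.C 2 + Polynomial.C 4)))
        + Polynomial.C 4) + Polynomial.C 2)))), fun x σ hx => ?_⟩
  simp only [Polynomial.eval_add, Polynomial.eval_C, Polynomial.eval_mul, Polynomial.eval_X]
  refine (hp x σ hx).seq fun σ₁ r₁ => ?_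
  have hx₁ := hx.of_result (fun i hi => (hloc i hi).trans (by omega)) r₁
  refine (hq x σ₁ hx₁).seq fun σ₂ r₂ => Exec.seq (Exec.assign rfl) fun σ₃ h₃ =>
    Exec.seq (Exec.assign rfl) fun σ₄ h₄ => ?_
  let Inv : ℕ → State → Prop := fun i τ => τ.mem = σ.mem ∧ (∀ j < e, τ.reg j = σ.reg j) ∧
    τ.reg e = i ∧ τ.reg (e + 1) = Nat.rec (g x) (fun i acc => h ((x, i), acc)) i ∧
    τ.reg (e + 2) = f x
  have h0 : Inv 0 σ₄ := by
    subst h₄ h₃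
    refine ⟨r₂.mem.trans r₁.mem, fun j hj => ?_, ?_, ?_, ?_⟩
    · have h1 : j ≠ e := by omega
      have h2 : j ≠ e + 1 := by omega
      simp [h1, h2, r₂.reg j (by omega), r₁.reg j (by omega)]
    · simp [Expr.eval]
    · simp [Expr.eval, r₂.out]
    · simp [r₂.reg (e + 2) (by omega), r₁.out]
  refine Exec.seq (Q := Inv (f x)) ?_ fun σ₅ h₅ => Exec.assign ?_
  · refine (Exec.loop Inv (N := f x) (B := B.eval (Γ.cap x) + (2 + 4)) ?_ ?_ h0).mono
      (fun _ h => h) ?_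
    · rintro i hi τ ⟨i₁, i₂, i₃, i₄, i₅⟩
      refine ⟨by simp only [Expr.eval, i₃, i₅]; omega, ?_⟩
      have hrep : ((Γ.ext fun x i => i < f x).ext fun _ _ => True).Rep loc'
          ((x, i), τ.reg (e + 1)) τ := by
        refine ⟨⟨⟨hx.valid, hi⟩, trivial⟩, i₁.trans hx.mem, fun j hj => ?_⟩
        simp only [Ctx.ext] at hj ⊢
        by_cases hj₁ : j < Γ.arity
        · simp only [loc', hj₁, if_true, Nat.lt_succ_of_lt hj₁]
          rw [i₂ _ (hloc j hj₁), hx.reg j hj₁]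
        · by_cases hj₂ : j = Γ.arity
          · simp [loc', hj₂, i₃]
          · simp [loc', hj₁, hj₂, show ¬ j < Γ.arity + 1 by omega]
      refine (hb _ τ hrep).seq fun τ₁ s₁ => Exec.seq (Exec.assign rfl) fun τ₂ s₂ =>
        Exec.assign ?_
      subst s₂
      refine ⟨s₁.mem.trans i₁, fun j hj => ?_, ?_, ?_, ?_⟩
      · have h1 : j ≠ e := by omega
        have h2 : j ≠ e + 1 := by omega
        simp [h1, h2, s₁.reg j (by omega), i₂ j hj]
      · simp [Expr.eval, s₁.reg e (by omega), i₃]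
      · simp [Expr.eval, s₁.out, i₄]
      · simp [s₁.reg (e + 2) (by omega), i₅]
    · rintro τ ⟨-, -, i₃, -, i₅⟩
      simp [Expr.eval, i₃, i₅]
    · simp only [Expr.cost]
      gcongr
      exact hcap x hx.valid
  · obtain ⟨i₁, i₂, -, i₄, -⟩ := h₅
    refine ⟨i₁, fun j hj => ?_, ?_⟩
    · simp [hj.ne, i₂ j hj]
    · simp [Expr.eval, i₄]

/-! ### Bounded sums, products and powers -/

theorem Cmp.sum {Γ : Ctx X} {f : X → ℕ} {g : X × ℕ → ℕ} (hf : Cmp Γ f)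
    (hcap : ∀ x, Γ.Valid x → f x ≤ Γ.cap x) (hg : Cmp (Γ.ext fun x i => i < f x) g) :
    Cmp Γ (fun x => ∑ i ∈ Finset.range (f x), g (x, i)) := by
  refine (Cmp.rec hf hcap (Cmp.const Γ 0) ((Cmp.last _ _).add (hg.weaken _))).congr fun x _ => ?_
  induction f x with
  | zero => simp
  | succ n ih => rw [Finset.sum_range_succ, ← ih]

/-- Multiplication is repeated addition, so only the factor that counts the rounds has to be small.
-/
theorem Cmp.mul {Γ : Ctx X} {f g : X → ℕ} (hf : Cmp Γ f) (hg : Cmp Γ g)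
    (hcap : ∀ x, Γ.Valid x → g x ≤ Γ.cap x) : Cmp Γ (fun x => f x * g x) :=
  (Cmp.sum hg hcap (hf.weaken _)).congr fun x _ => by simp [Nat.mul_comm]

/-- The accumulator starts at `f x` and is multiplied by `g x` in each round. Neither `f x` nor the
power need be bounded by `Γ.cap x`, so `Cmp.mul` would not apply to the two of them. -/
theorem Cmp.mul_pow {Γ : Ctx X} {f g h : X → ℕ} (hf : Cmp Γ f) (hg : Cmp Γ g) (hh : Cmp Γ h)
    (hgcap : ∀ x, Γ.Valid x → g x ≤ Γ.cap x) (hhcap : ∀ x, Γ.Valid x → h x ≤ Γ.cap x) :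
    Cmp Γ (fun x => f x * g x ^ h x) := by
  refine (Cmp.rec hh hhcap hf ((Cmp.last _ _).mul ((hg.weaken _).weaken _)
    fun x hx => hgcap _ hx.1.1)).congr fun x _ => ?_
  induction h x with
  | zero => simp
  | succ n ih => rw [pow_succ, ← mul_assoc, ← ih]

theorem Cmp.two_pow {Γ : Ctx X} {f : X → ℕ} (hf : Cmp Γ f)
    (hcap : ∀ x, Γ.Valid x → f x ≤ Γ.cap x) : Cmp Γ (fun x => 2 ^ f x) := by
  refine (Cmp.rec hf hcap (Cmp.const Γ 1) ((Cmp.last _ _).add (Cmp.last _ _))).congr fun x _ => ?_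
  induction f x with
  | zero => simp
  | succ n ih => rw [pow_succ, ← ih, Nat.mul_two]

/-! ### Decidable predicates -/

/-- The predicate `P` can be decided in polynomial time. -/
def CmpPred (Γ : Ctx X) (P : X → Prop) : Prop :=
  ∃ f, Cmp Γ f ∧ ∀ x, Γ.Valid x → (f x ≠ 0 ↔ P x)

theorem CmpPred.ite {Γ : Ctx X} {P : X → Prop} {_ : DecidablePred P} {f g : X → ℕ} (hP : CmpPred Γ P)
    (hf : Cmp Γ f) (hg : Cmp Γ g) : Cmp Γ (fun x => if P x then f x else g x) := by
  obtain ⟨b, hb, h⟩ := hP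
  exact (hb.cond hf hg).congr fun x hx => by simp only [h x hx]

theorem CmpPred.congr {Γ : Ctx X} {P Q : X → Prop} (hP : CmpPred Γ P)
    (h : ∀ x, Γ.Valid x → (P x ↔ Q x)) : CmpPred Γ Q := by
  obtain ⟨b, hb, hb'⟩ := hP
  exact ⟨b, hb, fun x hx => (hb' x hx).trans (h x hx)⟩

theorem CmpPred.not {Γ : Ctx X} {P : X → Prop} (hP : CmpPred Γ P) : CmpPred Γ (fun x => ¬ P x) := by
  obtain ⟨b, hb, h⟩ := hP
  exact ⟨_, (Cmp.const Γ 1).sub hb, fun x hx => by dsimp only; rw [← h x hx]; omega⟩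

theorem CmpPred.or {Γ : Ctx X} {P Q : X → Prop} (hP : CmpPred Γ P) (hQ : CmpPred Γ Q) :
    CmpPred Γ (fun x => P x ∨ Q x) := by
  obtain ⟨b, hb, h⟩ := hP
  obtain ⟨b', hb', h'⟩ := hQ
  exact ⟨_, hb.add hb', fun x hx => by dsimp only; rw [← h x hx, ← h' x hx]; omega⟩

theorem CmpPred.and {Γ : Ctx X} {P Q : X → Prop} (hP : CmpPred Γ P) (hQ : CmpPred Γ Q) :
    CmpPred Γ (fun x => P x ∧ Q x) :=
  (hP.not.or hQ.not).not.congr fun x _ => by tauto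

theorem Cmp.eq {Γ : Ctx X} {f g : X → ℕ} (hf : Cmp Γ f) (hg : Cmp Γ g) :
    CmpPred Γ (fun x => f x = g x) :=
  ⟨_, (Cmp.const Γ 1).sub ((hf.sub hg).add (hg.sub hf)), fun x _ => by omega⟩

end RAM

/-! ### Subsets as bit masks and Vandermonde determinants -/

open Finset in
-- The exponents below `a` contribute less than `2 ^ a`, and those above `a` a multiple of `2 ^ (a +
-- 1)`; only `a` itself affects the bit.
theorem sum_two_pow_div_mod (A : Finset ℕ) (a : ℕ) :
    (∑ s ∈ A, 2 ^ s) / 2 ^ a % 2 = if a ∈ A then 1 else 0 := by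
  have h₁ := Nat.geomSum_lt (m := 2) (n := a) (s := A.filter (· < a)) le_rfl (by simp)
  have h₂ : 2 ^ (a + 1) ∣ ∑ s ∈ (A.filter (¬ · < a)).filter (¬ · = a), 2 ^ s :=
    Finset.dvd_sum fun s hs => by
      simp only [mem_filter, not_lt] at hs
      exact pow_dvd_pow 2 (by omega)
  have h₃ : ∑ s ∈ (A.filter (¬ · < a)).filter (· = a), 2 ^ s = if a ∈ A then 2 ^ a else 0 := by
    rw [filter_filter, sum_filter, ← sum_filter, show A.filter (fun s => ¬ s < a ∧ s = a) =
      A.filter (· = a) from filter_congr fun s _ => by omega, filter_eq']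
    split_ifs <;> simp
  obtain ⟨b, hb⟩ := h₂
  rw [← sum_filter_add_sum_filter_not A (· < a), ← sum_filter_add_sum_filter_not
    (A.filter (¬ · < a)) (· = a), h₃, hb, pow_succ]
  have h₄ : (if a ∈ A then 2 ^ a else 0) = 2 ^ a * (if a ∈ A then 1 else 0) := by simp
  rw [h₄, mul_assoc, ← mul_add, Nat.add_mul_div_left _ _ (by positivity), Nat.div_eq_of_lt h₁]
  split_ifs <;> omega

/-- The number of elements below `a` of the set with bit mask `S`. -/
def maskRank (S a : ℕ) : ℕ := ∑ s ∈ Finset.range a, S / 2 ^ s % 2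

/-- The generalized Vandermonde determinant with the rows `xs` and with the set of exponents that is
given by a bit mask, defined by expansion along the first row. -/
def maskDet (L : ℕ) : List ℕ → ℕ → ℤ
  | [], S => if S = 0 then 1 else 0
  | x :: xs, S => ∑ a ∈ Finset.range L,
      if S / 2 ^ a % 2 = 1 then (-1) ^ maskRank S a * x ^ a * maskDet L xs (S - 2 ^ a) else 0

theorem mask_div_mod {m : ℕ} {e : Fin m → ℕ} (he : StrictMono e) (a : ℕ) :
    (∑ j, 2 ^ e j) / 2 ^ a % 2 = if ∃ j, e j = a then 1 else 0 := by
  have h := sum_two_pow_div_mod (Finset.univ.map ⟨e, he.injective⟩) a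
  simpa using h

/-- This identifies the sign used in `maskDet` with the sign `(-1) ^ j` of the Laplace expansion. -/
theorem maskRank_mask {m : ℕ} {e : Fin m → ℕ} (he : StrictMono e) (j : Fin m) :
    maskRank (∑ j, 2 ^ e j) (e j) = j := by
  classical
  simp only [maskRank, mask_div_mod he, Finset.sum_boole, Nat.cast_id]
  rw [show (Finset.range (e j)).filter (fun s => ∃ i, e i = s) = (Finset.Iio j).image e from ?_,
    Finset.card_image_of_injective _ he.injective, Fin.card_Iio]
  ext s
  simp only [Finset.mem_filter, Finset.mem_range, Finset.mem_image, Finset.mem_Iio]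
  constructor
  · rintro ⟨h, i, rfl⟩
    exact ⟨i, he.lt_iff_lt.1 h, rfl⟩
  · rintro ⟨i, h, rfl⟩
    exact ⟨he h, i, rfl⟩

/-- Laplace expansion along row `0`: deleting column `j` replaces `e` by its composition with
`Fin.succAbove j`, which clears the bit `e j` of the mask. -/
theorem maskDet_mask {L m : ℕ} (xs : List ℕ) {e : Fin m → ℕ} (he : StrictMono e)
    (heL : ∀ j, e j < L) (hm : xs.length = m) :
    maskDet L xs (∑ j, 2 ^ e j) =
      (Matrix.of fun i j : Fin m => (xs.getD i 0 : ℤ) ^ e j).det := by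
  induction xs generalizing m with
  | nil =>
    obtain rfl : m = 0 := by simpa using hm.symm
    simp [maskDet]
  | cons x xs ih =>
    obtain ⟨m, rfl⟩ : ∃ m', m = m' + 1 := ⟨xs.length, by simpa using hm.symm⟩
    rw [Matrix.det_succ_row_zero, maskDet]
    have hsum : ∀ g : ℕ → ℤ, (∑ a ∈ Finset.range L, if ∃ j, e j = a then g a else 0) =
        ∑ j, g (e j) := by
      intro g
      rw [← Finset.sum_filter, ← Finset.sum_image (s := Finset.univ) (g := e) (f := g)
        (fun a _ b _ h => he.injective h)]
      refine Finset.sum_congr ?_ fun _ _ => rfl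
      ext a
      simp only [Finset.mem_filter, Finset.mem_range, Finset.mem_image, Finset.mem_univ, true_and,
        and_iff_right_iff_imp]
      rintro ⟨j, rfl⟩
      exact heL j
    have hbit : ∀ a, ((∑ j, 2 ^ e j) / 2 ^ a % 2 = 1 ↔ ∃ j, e j = a) := fun a => by
      rw [mask_div_mod he]
      split_ifs with h <;> simp [h]
    simp only [hbit]
    rw [hsum fun a => (-1) ^ maskRank (∑ j, 2 ^ e j) a * (x : ℤ) ^ a *
      maskDet L xs (∑ j, 2 ^ e j - 2 ^ a)]
    refine Finset.sum_congr rfl fun j _ => ?_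
    rw [maskRank_mask he, Fin.sum_univ_succAbove _ j, Nat.add_sub_cancel_left]
    have hj := ih (he.comp (Fin.strictMono_succAbove j)) (fun i => heL _) (by simpa using hm)
    simp only [Function.comp_apply] at hj
    rw [hj]
    rfl

/-- The full mask stands for the exponents `0, …, L - 1`, so this is the ordinary Vandermonde
determinant. -/
theorem maskDet_full_ne_zero_iff {L : ℕ} (xs : List ℕ) (h : xs.length = L) :
    maskDet L xs (2 ^ L - 1) ≠ 0 ↔ xs.Nodup := by
  subst h
  have hmask : 2 ^ xs.length - 1 = ∑ j : Fin xs.length, 2 ^ (j : ℕ) := by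
    rw [Fin.sum_univ_eq_sum_range (fun j => 2 ^ j), Nat.geomSum_eq le_rfl]
    simp
  rw [hmask, maskDet_mask xs (e := fun j => j) (fun _ _ h => h) (fun j => j.2) rfl,
    show (Matrix.of fun i j : Fin xs.length => (xs.getD i 0 : ℤ) ^ (j : ℕ)) =
      Matrix.vandermonde (fun i : Fin xs.length => (xs.getD i 0 : ℤ)) from rfl,
    Matrix.det_vandermonde_ne_zero_iff, List.nodup_iff_injective_get]
  refine ⟨fun H i j hij => H ?_, fun H i j hij => H ?_⟩
  · simpa using hij
  · simpa using hij

/-! ### Counting labeled walks, weighted by squared Vandermonde determinants -/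

/-- A nondeterministic automaton with time-dependent transitions between pairs `(v, c)` with `v < n`
and `c < q`; each transition has a natural number as its label. -/
structure LabeledAutomaton where
  n : ℕ
  q : ℕ
  init : ℕ → ℕ → Prop
  rel : ℕ → ℕ → ℕ → ℕ → ℕ → Prop
  lab : ℕ → ℕ → ℕ → ℕ → ℕ

namespace LabeledAutomaton

variable (A : LabeledAutomaton)

/-- `xs` is the list of labels, the last one first, of a run of `j` transitions to `(v, c)`. -/
def IsRun : ℕ → ℕ → ℕ → List ℕ → Prop
  | 0, v, c, xs => A.init v c ∧ xs = []
  | j + 1, v, c, xs => ∃ u < A.n, ∃ d < A.q, A.rel j u d v c ∧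
      ∃ ys, IsRun j u d ys ∧ xs = A.lab j u v c :: ys

theorem IsRun.length_eq {A : LabeledAutomaton} {j v c : ℕ} {xs : List ℕ} (h : A.IsRun j v c xs) :
    xs.length = j := by
  induction j generalizing v c xs with
  | zero => simp [h.2]
  | succ j ih =>
    obtain ⟨u, -, d, -, -, ys, hy, rfl⟩ := h
    simp [ih hy]

/-- The recursive form of a run serves the counting; the form as one sequence `w` of states serves
the translation into paths. -/
theorem isRun_iff {j v c : ℕ} {xs : List ℕ} : A.IsRun j v c xs ↔
    ∃ w : ℕ → ℕ × ℕ, A.init (w 0).1 (w 0).2 ∧ w j = (v, c) ∧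
      (∀ i < j, (w i).1 < A.n ∧ (w i).2 < A.q ∧
        A.rel i (w i).1 (w i).2 (w (i + 1)).1 (w (i + 1)).2) ∧
      xs = ((List.range j).map fun i =>
        A.lab i (w i).1 (w (i + 1)).1 (w (i + 1)).2).reverse := by
  induction j generalizing v c xs with
  | zero =>
    constructor
    · rintro ⟨h, rfl⟩
      exact ⟨fun _ => (v, c), h, rfl, by simp, rfl⟩
    · rintro ⟨w, h, hw, -, rfl⟩
      rw [hw] at h
      exact ⟨h, rfl⟩
  | succ j ih =>
    constructor
    · rintro ⟨u, hu, d, hd, hr, ys, hy, rfl⟩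
      obtain ⟨w, h0, hj, hs, rfl⟩ := ih.1 hy
      refine ⟨fun i => if i ≤ j then w i else (v, c), by simpa using h0, by simp, ?_, ?_⟩
      · intro i hi
        rcases Nat.lt_succ_iff_lt_or_eq.1 hi with hi' | rfl
        · simpa [hi'.le, Nat.succ_le_of_lt hi'] using hs i hi'
        · simp [hj, hu, hd, hr]
      · rw [List.range_succ, List.map_append, List.reverse_append]
        simp only [List.map_cons, List.map_nil, List.reverse_cons, List.reverse_nil, List.nil_append,
          le_refl, if_true, hj, List.cons_append, Nat.not_succ_le_self, if_false]
        congr 2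
        refine List.map_congr_left fun i hi => ?_
        have hi' := List.mem_range.1 hi
        simp [hi'.le, Nat.succ_le_of_lt hi']
    · rintro ⟨w, h0, hj, hs, rfl⟩
      obtain ⟨hu, hd, hr⟩ := hs j (Nat.lt_succ_self j)
      rw [hj] at hr
      refine ⟨_, hu, _, hd, hr, _, ih.2 ⟨w, h0, rfl, fun i hi => hs i (hi.trans
        (Nat.lt_succ_self j)), rfl⟩, ?_⟩
      simp [List.range_succ, hj]

open Classical in
/-- The sum of a function of the label lists over all runs of `j` transitions to `(v, c)`. -/
noncomputable def runSum : ℕ → ℕ → ℕ → (List ℕ → ℤ) →ₗ[ℤ] ℤ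
  | 0, v, c => if A.init v c then LinearMap.proj [] else 0
  | j + 1, v, c => ∑ u ∈ Finset.range A.n, ∑ d ∈ Finset.range A.q,
      if A.rel j u d v c then
        runSum j u d ∘ₗ LinearMap.funLeft ℤ ℤ (fun xs => A.lab j u v c :: xs)
      else 0

open Classical in
-- A sum of nonnegative terms is positive exactly when one of them is. The function `φ` stays
-- general because the induction step prepends a label to its argument.
theorem runSum_pos (j v c : ℕ) (φ : List ℕ → ℤ) (hφ : ∀ xs, 0 ≤ φ xs) :
    0 ≤ A.runSum j v c φ ∧ (0 < A.runSum j v c φ ↔ ∃ xs, A.IsRun j v c xs ∧ 0 < φ xs) := by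
  induction j generalizing v c φ with
  | zero => by_cases h : A.init v c <;> simp [runSum, IsRun, h, hφ]
  | succ j ih =>
    have hterm : ∀ u d, 0 ≤ (if A.rel j u d v c then A.runSum j u d ∘ₗ LinearMap.funLeft ℤ ℤ
        (fun xs => A.lab j u v c :: xs) else 0 : (List ℕ → ℤ) →ₗ[ℤ] ℤ) φ := fun u d => by
      split_ifs
      · exact (ih u d _ fun xs => hφ _).1
      · simp
    simp only [runSum, LinearMap.sum_apply]
    refine ⟨Finset.sum_nonneg fun u _ => Finset.sum_nonneg fun d _ => hterm u d, ?_⟩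
    rw [Finset.sum_pos_iff_of_nonneg fun u _ => Finset.sum_nonneg fun d _ => hterm u d]
    simp only [Finset.sum_pos_iff_of_nonneg fun d (_ : d ∈ Finset.range A.q) => hterm _ d,
      Finset.mem_range, IsRun]
    constructor
    · rintro ⟨u, hu, d, hd, h⟩
      split_ifs at h with hr
      · obtain ⟨ys, hy, hpos⟩ := (ih u d _ fun xs => hφ _).2.1 h
        exact ⟨_, ⟨u, hu, d, hd, hr, ys, hy, rfl⟩, hpos⟩
      · simp at h
    · rintro ⟨_, ⟨u, hu, d, hd, hr, ys, hy, rfl⟩, hpos⟩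
      refine ⟨u, hu, d, hd, ?_⟩
      rw [if_pos hr]
      exact (ih u d _ fun xs => hφ _).2.2 ⟨ys, hy, hpos⟩

open Classical in
/-- The natural numbers from which the sum of the products of two determinants over all runs of `j`
transitions is obtained as the difference of the values at `ε = 0` and `ε = 1`. -/
noncomputable def signedCount (L : ℕ) : ℕ → ℕ → ℕ → ℕ → ℕ → ℕ → ℕ
  | 0, ε, S, T, v, c => if (ε = 0 ∧ S = 0 ∧ T = 0) ∧ A.init v c then 1 else 0
  | j + 1, ε, S, T, v, c =>
      ∑ a ∈ Finset.range L, ∑ b ∈ Finset.range L, ∑ u ∈ Finset.range A.n, ∑ d ∈ Finset.range A.q,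
        if (S / 2 ^ a % 2 = 1 ∧ T / 2 ^ b % 2 = 1) ∧ A.rel j u d v c then
          signedCount L j ((ε + (maskRank S a + maskRank T b)) % 2) (S - 2 ^ a) (T - 2 ^ b) u d *
            A.lab j u v c ^ (a + b)
        else 0

open Classical in
-- Both determinants are expanded along the row of the last label; linearity of `runSum` then moves
-- the expansion out of the sum over shorter runs, and the induction hypothesis applies to the
-- minors.
theorem signedCount_sub (L j S T v c : ℕ) :
    (A.signedCount L j 0 S T v c : ℤ) - A.signedCount L j 1 S T v c =
      A.runSum j v c (fun xs => maskDet L xs S * maskDet L xs T) := by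
  induction j generalizing S T v c with
  | zero =>
    by_cases h : A.init v c
    · by_cases hS : S = 0 <;> by_cases hT : T = 0 <;> simp [signedCount, runSum, maskDet, h, hS, hT]
    · simp [signedCount, runSum, h]
  | succ j ih =>
    -- An odd `r` exchanges the two parity classes, which changes the sign of their difference.
    have hsign : ∀ r S T u d, (A.signedCount L j ((0 + r) % 2) S T u d : ℤ) -
        A.signedCount L j ((1 + r) % 2) S T u d =
        (-1) ^ r * A.runSum j u d (fun xs => maskDet L xs S * maskDet L xs T) := by
      intro r S T u d
      rw [← ih]
      rcases Nat.even_or_odd r with hr | hr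
      · rw [hr.neg_one_pow, show (0 + r) % 2 = 0 by grind, show (1 + r) % 2 = 1 by grind]
        ring
      · rw [hr.neg_one_pow, show (0 + r) % 2 = 1 by grind, show (1 + r) % 2 = 0 by grind]
        ring
    have hexp : ∀ u, LinearMap.funLeft ℤ ℤ (fun xs => A.lab j u v c :: xs)
        (fun xs => maskDet L xs S * maskDet L xs T) =
        ∑ a ∈ Finset.range L, ∑ b ∈ Finset.range L,
          if S / 2 ^ a % 2 = 1 ∧ T / 2 ^ b % 2 = 1 then
            ((-1) ^ (maskRank S a + maskRank T b) * (A.lab j u v c : ℤ) ^ (a + b)) •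
              (fun xs => maskDet L xs (S - 2 ^ a) * maskDet L xs (T - 2 ^ b))
          else 0 := by
      intro u
      ext xs
      simp only [LinearMap.funLeft_apply, maskDet, Finset.sum_apply, Finset.sum_mul_sum]
      refine Finset.sum_congr rfl fun a _ => Finset.sum_congr rfl fun b _ => ?_
      by_cases h₁ : S / 2 ^ a % 2 = 1 <;> by_cases h₂ : T / 2 ^ b % 2 = 1 <;>
        simp [h₁, h₂, pow_add]
      ring
    simp only [signedCount, runSum, LinearMap.sum_apply]
    push_cast
    simp only [← Finset.sum_sub_distrib]
    have hR : ∀ u d, (if A.rel j u d v c then A.runSum j u d ∘ₗ LinearMap.funLeft ℤ ℤ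
        (fun xs => A.lab j u v c :: xs) else 0 : (List ℕ → ℤ) →ₗ[ℤ] ℤ)
          (fun xs => maskDet L xs S * maskDet L xs T) =
        ∑ a ∈ Finset.range L, ∑ b ∈ Finset.range L,
          if (S / 2 ^ a % 2 = 1 ∧ T / 2 ^ b % 2 = 1) ∧ A.rel j u d v c then
            ((-1) ^ (maskRank S a + maskRank T b) * (A.lab j u v c : ℤ) ^ (a + b)) *
              A.runSum j u d (fun xs => maskDet L xs (S - 2 ^ a) * maskDet L xs (T - 2 ^ b))
          else 0 := by
      intro u d
      by_cases hr : A.rel j u d v c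
      · simp only [hr, if_true, and_true, LinearMap.comp_apply, hexp, map_sum]
        refine Finset.sum_congr rfl fun a _ => Finset.sum_congr rfl fun b _ => ?_
        split_ifs
        · rw [map_smul, smul_eq_mul]
        · rw [map_zero]
      · simp [hr]
    simp only [hR]
    rw [Finset.sum_congr rfl fun a _ => Finset.sum_comm, Finset.sum_comm]
    refine Finset.sum_congr rfl fun u _ => ?_
    rw [Finset.sum_congr rfl fun a _ => Finset.sum_comm, Finset.sum_comm]
    refine Finset.sum_congr rfl fun d _ => Finset.sum_congr rfl fun a _ =>
      Finset.sum_congr rfl fun b _ => ?_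
    split_ifs with h
    · rw [← sub_mul, hsign]
      ring
    · simp

/-- There is a run of `L` transitions to `(v, c)` with distinct labels if and only if the signed
count is positive. -/
theorem signedCount_lt_iff (L v c : ℕ) :
    A.signedCount L L 1 (2 ^ L - 1) (2 ^ L - 1) v c ≤
      A.signedCount L L 0 (2 ^ L - 1) (2 ^ L - 1) v c ∧
    (A.signedCount L L 1 (2 ^ L - 1) (2 ^ L - 1) v c <
      A.signedCount L L 0 (2 ^ L - 1) (2 ^ L - 1) v c ↔
      ∃ xs, A.IsRun L v c xs ∧ xs.Nodup) := by
  have h := A.signedCount_sub L L (2 ^ L - 1) (2 ^ L - 1) v c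
  obtain ⟨h₁, h₂⟩ := A.runSum_pos L v c
    (fun xs => maskDet L xs (2 ^ L - 1) * maskDet L xs (2 ^ L - 1)) fun xs => mul_self_nonneg _
  rw [← h] at h₁ h₂
  refine ⟨by omega, ?_⟩
  rw [← Int.ofNat_lt, ← sub_pos, h₂]
  refine exists_congr fun xs => and_congr_right fun hx => ?_
  rw [← maskDet_full_ne_zero_iff xs hx.length_eq, mul_self_pos]

end LabeledAutomaton

/-! ### Color disjoint paths as runs of an automaton -/

namespace SimpleGraph.Walk

variable {V : Type*} {G : SimpleGraph V}

theorem mem_edges_iff_exists_getVert {u v : V} (p : G.Walk u v) (e : Sym2 V) :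
    e ∈ p.edges ↔ ∃ i < p.length, e = s(p.getVert i, p.getVert (i + 1)) := by
  induction p with
  | nil => simp
  | cons h p ih =>
    rw [edges_cons, List.mem_cons, ih]
    constructor
    · rintro (rfl | ⟨i, hi, rfl⟩)
      · exact ⟨0, by simp, by simp⟩
      · exact ⟨i + 1, by simpa using hi, by simp⟩
    · rintro ⟨i, hi, rfl⟩
      cases i with
      | zero => simp
      | succ i => exact Or.inr ⟨i, by simpa using hi, by simp⟩

theorem exists_getVert_eq (f : ℕ → V) (m : ℕ) (h : ∀ i < m, G.Adj (f i) (f (i + 1))) :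
    ∃ p : G.Walk (f 0) (f m), p.length = m ∧ ∀ i ≤ m, p.getVert i = f i := by
  induction m generalizing f with
  | zero => exact ⟨nil, rfl, by simp⟩
  | succ m ih =>
    obtain ⟨p, hp, hpf⟩ := ih (fun i => f (i + 1)) fun i hi => h (i + 1) (by omega)
    refine ⟨cons (h 0 (by omega)) p, by simp [hp], fun i hi => ?_⟩
    cases i with
    | zero => simp
    | succ i => simpa using hpf i (by omega)

end SimpleGraph.Walk

namespace LMaxCDDP

variable (I : LMaxCDDP)

/-- The edge `uv` exists and is colored by `c`, for numbers in place of vertices and colors. -/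
def Colored (u v c : ℕ) : Prop :=
  ∃ (hu : u < I.n) (hv : v < I.n) (hc : c < I.q), I.G.EdgeHasColor ⟨u, hu⟩ ⟨v, hv⟩ ⟨c, hc⟩

/-- The number of transitions of an accepting run. -/
def steps : ℕ := I.k * (I.l + 1)

/-- The runs run through `k` paths one after the other, taking one transition for the choice of a
color and a jump to `s`, followed by `l` transitions along the path or, at its end, staying there.
The labels are distinct if the paths are simple, internally disjoint and of distinct colors,
and at most one of them is the edge `st`. -/
def automaton : LabeledAutomaton where
  n := I.n
  q := I.q
  init v c := v = I.t ∧ c = 0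
  rel j u d v c :=
    (j % (I.l + 1) = 0 ∧ u = I.t ∧ v = I.s) ∨
    (¬ j % (I.l + 1) = 0 ∧ d = c ∧ ¬ v = I.s ∧
      ((u = I.t ∧ v = I.t) ∨ (¬ u = I.t ∧ I.Colored u v c)))
  lab j u v c :=
    if j % (I.l + 1) = 0 then I.n + c
    else if v = I.t then if u = I.s then I.s else I.n + I.q + j
    else v

variable {I}

/-- Labels of color choices are at least `n`, so distinct labels force distinct colors, and interior
vertices are their own labels, so no two of them coincide. Arrivals at `t` and waiting steps have
labels that depend on the time, since all paths share `t`. The exception is a step from `s` straight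
to `t`: it is labeled `s`, which prevents the path with the single edge `st` from being used twice.
-/
theorem isYes_of_run (w : ℕ → ℕ × ℕ) (hend : (w I.steps).1 = I.t)
    (hendc : (w I.steps).2 < I.q)
    (hrel : ∀ i < I.steps, (w i).1 < I.n ∧ (w i).2 < I.q ∧
      I.automaton.rel i (w i).1 (w i).2 (w (i + 1)).1 (w (i + 1)).2)
    (hlab : ∀ i < I.steps, ∀ i' < I.steps,
      I.automaton.lab i (w i).1 (w (i + 1)).1 (w (i + 1)).2 =
      I.automaton.lab i' (w i').1 (w (i' + 1)).1 (w (i' + 1)).2 → i = i') : I.IsYes := by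
  have hst : (I.s : ℕ) ≠ I.t := fun h => I.s_ne_t (Fin.ext h)
  have hlt : ∀ b < I.k, ∀ r ≤ I.l, b * (I.l + 1) + r < I.steps := fun b hb r hr =>
    calc b * (I.l + 1) + r < (b + 1) * (I.l + 1) := by rw [Nat.succ_mul]; omega
      _ ≤ _ := Nat.mul_le_mul_right _ hb
  have hmod : ∀ b r, r ≤ I.l → (b * (I.l + 1) + r) % (I.l + 1) = r := fun b r hr => by
    rw [Nat.add_comm, Nat.add_mul_mod_self_right, Nat.mod_eq_of_lt (by omega)]
  have hdiv : ∀ b r, r ≤ I.l → (b * (I.l + 1) + r) / (I.l + 1) = b := fun b r hr => by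
    rw [Nat.add_comm, Nat.add_mul_div_right _ _ (by omega), Nat.div_eq_of_lt (by omega), zero_add]
  have hrange : ∀ i ≤ I.steps, (w i).1 < I.n ∧ (w i).2 < I.q := fun i hi => by
    rcases hi.lt_or_eq with h | rfl
    · exact ⟨(hrel i h).1, (hrel i h).2.1⟩
    · exact ⟨hend ▸ I.t.2, hendc⟩
  -- the vertices and the color of the path number `b`
  let f : ℕ → ℕ → ℕ := fun b r => (w (b * (I.l + 1) + r + 1)).1
  let c : ℕ → ℕ := fun b => (w (b * (I.l + 1) + 1)).2
  have hf0 : ∀ b < I.k, f b 0 = I.s := fun b hb => by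
    rcases (hrel _ (hlt b hb 0 (Nat.zero_le _))).2.2 with h | h
    · exact h.2.2
    · exact absurd (hmod b 0 (Nat.zero_le _)) h.1
  have hstep : ∀ b < I.k, ∀ r < I.l,
      (w (b * (I.l + 1) + r + 1)).2 = (w (b * (I.l + 1) + r + 1 + 1)).2 ∧ f b (r + 1) ≠ I.s ∧
      ((f b r = I.t ∧ f b (r + 1) = I.t) ∨
        (f b r ≠ I.t ∧ I.Colored (f b r) (f b (r + 1)) (w (b * (I.l + 1) + r + 1 + 1)).2)) := by
    intro b hb r hr
    rcases (hrel _ (hlt b hb (r + 1) hr)).2.2 with h | h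
    · have := hmod b (r + 1) hr
      omega
    · exact h.2
  have hc : ∀ b < I.k, ∀ r ≤ I.l, (w (b * (I.l + 1) + r + 1)).2 = c b := by
    intro b hb r
    induction r with
    | zero => exact fun _ => rfl
    | succ r ih => exact fun hr => (hstep b hb r hr).1.symm.trans (ih (by omega))
  have hcq : ∀ b < I.k, c b < I.q := fun b hb => (hrange _ (hlt b hb 0 (Nat.zero_le _))).2
  have hfn : ∀ b < I.k, ∀ r ≤ I.l, f b r < I.n := fun b hb r hr => (hrange _ (hlt b hb r hr)).1
  -- The jump that opens the next block is only possible from `t`; for the last block this is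
  -- `hend`.
  have hfl : ∀ b < I.k, f b I.l = I.t := by
    intro b hb
    have hnext : b * (I.l + 1) + I.l + 1 = (b + 1) * (I.l + 1) := by ring
    rcases Nat.lt_or_ge (b + 1) I.k with h | h
    · rcases (hrel _ (hlt (b + 1) h 0 (Nat.zero_le _))).2.2 with h' | h'
      · simp only [f, hnext]
        exact h'.2.1
      · exact absurd (hmod (b + 1) 0 (Nat.zero_le _)) h'.1
    · have : b + 1 = I.k := by omega
      simp only [f, hnext, this]
      exact hend
  have hex : ∀ b < I.k, ∃ r, f b r = I.t := fun b hb => ⟨_, hfl b hb⟩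
  -- the first index at which `t` is reached
  have hm : ∀ b, ∃ m, b < I.k → f b m = I.t ∧ m ≤ I.l ∧ ∀ r < m, f b r ≠ I.t := by
    intro b
    by_cases hb : b < I.k
    · exact ⟨Nat.find (hex b hb), fun _ => ⟨Nat.find_spec (hex b hb),
        Nat.find_min' _ (hfl b hb), fun r hr => Nat.find_min (hex b hb) hr⟩⟩
    · exact ⟨0, fun h => absurd h hb⟩
  choose m hm using hm
  have hmpos : ∀ b < I.k, 0 < m b := fun b hb => Nat.pos_of_ne_zero fun h0 => by
    have := (hm b hb).1
    rw [h0, hf0 b hb] at this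
    exact hst this
  have hcol : ∀ b < I.k, ∀ r < m b, I.Colored (f b r) (f b (r + 1)) (c b) := by
    intro b hb r hr
    obtain ⟨-, hml, hne⟩ := hm b hb
    have h := hstep b hb r (by omega)
    rw [show (w (b * (I.l + 1) + r + 1 + 1)).2 = c b from hc b hb (r + 1) (by omega)] at h
    rcases h.2.2 with h' | h'
    · exact absurd h'.1 (hne r hr)
    · exact h'.2
  -- the interior vertices are labels
  have hinner : ∀ b < I.k, ∀ b' < I.k, ∀ r r', 0 < r → r < m b → 0 < r' → r' < m b' →
      f b r = f b' r' → b = b' ∧ r = r' := by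
    intro b hb b' hb' r r' hr hrm hr' hrm' h
    obtain ⟨-, hml, hne⟩ := hm b hb
    obtain ⟨-, hml', hne'⟩ := hm b' hb'
    have key : ∀ b < I.k, ∀ r, 0 < r → r < m b → r ≤ I.l → f b r ≠ I.t →
        I.automaton.lab (b * (I.l + 1) + r) (w (b * (I.l + 1) + r)).1
          (w (b * (I.l + 1) + r + 1)).1 (w (b * (I.l + 1) + r + 1)).2 = f b r := by
      intro b hb r hr hrm hrl hne
      have h₂ : ¬ (w (b * (I.l + 1) + r + 1)).1 = I.t := hne
      simp only [automaton, hmod b r hrl, hr.ne', if_false, h₂, f]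
    have := hlab _ (hlt b hb r (by omega)) _ (hlt b' hb' r' (by omega)) <| by
      rw [key b hb r hr hrm (by omega) (hne r hrm),
        key b' hb' r' hr' hrm' (by omega) (hne' r' hrm'), h]
    have hbb : b = b' := by
      rw [← hdiv b r (by omega), this, hdiv b' r' (by omega)]
    subst hbb
    exact ⟨rfl, by omega⟩
  have hdirect : ∀ b < I.k, ∀ b' < I.k, m b = 1 → m b' = 1 → b = b' := by
    intro b hb b' hb' h h'
    have key : ∀ b < I.k, m b = 1 →
        I.automaton.lab (b * (I.l + 1) + 1) (w (b * (I.l + 1) + 1)).1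
          (w (b * (I.l + 1) + 1 + 1)).1 (w (b * (I.l + 1) + 1 + 1)).2 = I.s := by
      intro b hb h
      have h₁ : f b 1 = I.t := by
        rw [← (hm b hb).1, h]
      replace h₁ : (w (b * (I.l + 1) + 1 + 1)).1 = I.t := h₁
      have h₂ : (w (b * (I.l + 1) + 1)).1 = I.s := hf0 b hb
      simp [automaton, hmod b 1 I.one_le_l, h₁, h₂]
    have := hlab _ (hlt b hb 1 I.one_le_l) _ (hlt b' hb' 1 I.one_le_l) <| by
      rw [key b hb h, key b' hb' h']
    rw [← hdiv b 1 I.one_le_l, this, hdiv b' 1 I.one_le_l]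
  have hcinj : ∀ b < I.k, ∀ b' < I.k, c b = c b' → b = b' := by
    intro b hb b' hb' h
    have := hlab _ (hlt b hb 0 (Nat.zero_le _)) _ (hlt b' hb' 0 (Nat.zero_le _)) <| by
      simp only [automaton, hmod _ 0 (Nat.zero_le _), if_true]
      exact congrArg _ h
    rw [← hdiv b 0 (Nat.zero_le _), this, hdiv b' 0 (Nat.zero_le _)]
  -- the paths
  have hpath : ∀ b : Fin I.k, ∃ p : I.G.graph.Path I.s I.t, p.1.length = m b ∧
      (∀ r ≤ m b, (p.1.getVert r : ℕ) = f b r) ∧ I.G.ColoredBy p ⟨c b, hcq b b.2⟩ := by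
    intro b
    obtain ⟨hmt, hml, hne⟩ := hm b b.2
    -- The default value is never used for `r ≤ m b`.
    let g : ℕ → Fin I.n := fun r => if h : f b r < I.n then ⟨f b r, h⟩ else I.s
    have hg : ∀ r ≤ m b, (g r : ℕ) = f b r := fun r hr => by
      simp only [g, dif_pos (hfn b b.2 r (hr.trans hml))]
    have hgcol : ∀ r < m b, I.G.EdgeHasColor (g r) (g (r + 1)) ⟨c b, hcq b b.2⟩ := fun r hr => by
      obtain ⟨h₁, h₂, h₃, h⟩ := hcol b b.2 r hr
      convert h using 1
      · exact Fin.ext (hg r hr.le)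
      · exact Fin.ext (hg (r + 1) hr)
    obtain ⟨p, hpl, hpg⟩ := SimpleGraph.Walk.exists_getVert_eq (G := I.G.graph) g (m b)
      fun r hr => (hgcol r hr).1
    have hgs : g 0 = I.s := Fin.ext ((hg 0 (Nat.zero_le _)).trans (hf0 b b.2))
    have hgt : g (m b) = I.t := Fin.ext ((hg _ le_rfl).trans hmt)
    have hpp : (p.copy hgs hgt).IsPath := by
      rw [← SimpleGraph.Walk.IsPath.getVert_injOn_iff]
      intro r hr r' hr' h
      simp only [Set.mem_ofPred_eq, SimpleGraph.Walk.length_copy, hpl] at hr hr'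
      simp only [SimpleGraph.Walk.getVert_copy, hpg r hr, hpg r' hr'] at h
      have h' : f b r = f b r' := by rw [← hg r hr, ← hg r' hr', h]
      have hs : ∀ r, 0 < r → r ≤ m b → f b r ≠ I.s := fun r h₀ hr => by
        obtain ⟨r, rfl⟩ := Nat.exists_eq_succ_of_ne_zero h₀.ne'
        exact (hstep b b.2 r (by omega)).2.1
      rcases Nat.eq_zero_or_pos r with rfl | h₁
      · rcases Nat.eq_zero_or_pos r' with rfl | h₂
        · rfl
        · exact absurd (h'.symm.trans (hf0 b b.2)) (hs r' h₂ hr')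
      · rcases Nat.eq_zero_or_pos r' with rfl | h₂
        · exact absurd (h'.trans (hf0 b b.2)) (hs r h₁ hr)
        · rcases hr.lt_or_eq with h₃ | rfl
          · rcases hr'.lt_or_eq with h₄ | rfl
            · exact (hinner b b.2 b b.2 r r' h₁ h₃ h₂ h₄ h').2
            · exact absurd (h'.trans hmt) (hne r h₃)
          · rcases hr'.lt_or_eq with h₄ | rfl
            · exact absurd (h'.symm.trans hmt) (hne r' h₄)
            · rfl
    refine ⟨⟨p.copy hgs hgt, hpp⟩, by simpa using hpl, fun r hr => ?_, fun e he => ?_⟩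
    · simp only [SimpleGraph.Walk.getVert_copy, hpg r hr, hg r hr]
    · have he' := he
      rw [SimpleGraph.Walk.edges_copy, SimpleGraph.Walk.mem_edges_iff_exists_getVert] at he'
      obtain ⟨r, hr, rfl⟩ := he'
      rw [hpl] at hr
      obtain ⟨h₁, h₂⟩ := hgcol r hr
      simp only [hpg r hr.le, hpg (r + 1) hr]
      exact h₂
  choose p hpl hpf hpc using hpath
  have hmem : ∀ (b : Fin I.k) (v : Fin I.n), v ∈ (p b).1.support → v = I.s ∨ v = I.t ∨
      ∃ r, 0 < r ∧ r < m b ∧ (v : ℕ) = f b r := by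
    intro b v hv
    obtain ⟨r, rfl, hr⟩ := SimpleGraph.Walk.mem_support_iff_exists_getVert.1 hv
    rw [hpl] at hr
    rcases Nat.eq_zero_or_pos r with rfl | h₁
    · simp
    · rcases hr.lt_or_eq with h₂ | rfl
      · exact Or.inr (Or.inr ⟨r, h₁, h₂, hpf b r hr⟩)
      · exact Or.inr (Or.inl (by rw [← hpl, SimpleGraph.Walk.getVert_length]))
  have hdisj : ∀ b b' : Fin I.k, b ≠ b' → I.G.InternallyDisjoint (p b) (p b') := by
    intro b b' hbb v hv hv'
    rcases hmem b v hv with h | h | ⟨r, hr, hrm, h⟩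
    · exact Or.inl h
    · exact Or.inr h
    rcases hmem b' v hv' with h' | h' | ⟨r', hr', hrm', h'⟩
    · exact Or.inl h'
    · exact Or.inr h'
    exact absurd (Fin.ext (hinner b b.2 b' b'.2 r r' hr hrm hr' hrm' (h.symm.trans h')).1) hbb
  -- Equal paths for `b ≠ b'` would have equal length. Length one is excluded by `hdirect`;
  -- otherwise vertex number `1` is interior to both, against `hdisj`.
  have hpinj : Function.Injective p := by
    intro b b' hbb
    by_contra hne
    have hlen : m b = m b' := by rw [← hpl, ← hpl, hbb]
    rcases (Nat.succ_le_of_lt (hmpos b b.2)).eq_or_lt with h | h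
    · exact hne (Fin.ext (hdirect b b.2 b' b'.2 h.symm (hlen ▸ h.symm)))
    · have h₁ := hpf b 1 h.le
      have hv := (p b).1.getVert_mem_support 1
      rcases hdisj b b' hne _ hv (hbb ▸ hv) with h₂ | h₂
      · exact (hstep b b.2 0 (I.one_le_l)).2.1 (by rw [← h₂, h₁])
      · exact (hm b b.2).2.2 1 h (by rw [← h₂, h₁])
  refine ⟨Finset.univ.map ⟨p, hpinj⟩, by simp, ?_,
    -- Outside the chosen paths any color will do; the final color of the run provides one.
    Function.extend p (fun b => ⟨c b, hcq b b.2⟩) (fun _ => ⟨_, hendc⟩), ?_, ?_⟩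
  · simp only [Finset.mem_map, Finset.mem_univ, true_and, Function.Embedding.coeFn_mk]
    rintro _ ⟨b, rfl⟩
    rw [hpl]
    exact (hm b b.2).2.1
  · simp only [Finset.mem_map, Finset.mem_univ, true_and, Function.Embedding.coeFn_mk]
    rintro _ ⟨b, rfl⟩
    rw [hpinj.extend_apply]
    exact hpc b
  · simp only [Finset.mem_map, Finset.mem_univ, true_and, Function.Embedding.coeFn_mk]
    rintro _ ⟨b, rfl⟩ _ ⟨b', rfl⟩ hbb
    have hne : b ≠ b' := fun h => hbb (by rw [h])
    refine ⟨hdisj b b' hne, ?_⟩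
    rw [hpinj.extend_apply, hpinj.extend_apply]
    exact fun h => hne (Fin.ext (hcinj b b.2 b' b'.2 (congrArg Fin.val h)))

theorem exists_run_of_isYes (h : I.IsYes) : ∃ w : ℕ → ℕ × ℕ, w 0 = ((I.t : ℕ), 0) ∧
    (w I.steps).1 = I.t ∧ (w I.steps).2 < I.q ∧
    (∀ i < I.steps, (w i).1 < I.n ∧ (w i).2 < I.q ∧
      I.automaton.rel i (w i).1 (w i).2 (w (i + 1)).1 (w (i + 1)).2) ∧
    ∀ i < I.steps, ∀ i' < I.steps,
      I.automaton.lab i (w i).1 (w (i + 1)).1 (w (i + 1)).2 =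
      I.automaton.lab i' (w i').1 (w (i' + 1)).1 (w (i' + 1)).2 → i = i' := by
  obtain ⟨P, hk, hl, χ, hχ, hd⟩ := h
  have hst : (I.s : ℕ) ≠ I.t := fun h => I.s_ne_t (Fin.ext h)
  obtain ⟨p, hpP, hpinj⟩ : ∃ p : ℕ → I.G.graph.Path I.s I.t,
      (∀ b < I.k, p b ∈ P) ∧ ∀ b < I.k, ∀ b' < I.k, p b = p b' → b = b' := by
    have hpos : 0 < P.card := I.k_pos.trans_le hk
    -- Repeating a path of `P` beyond its cardinality makes the enumeration total, so that `w` below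
    -- is defined at every time.
    refine ⟨fun b => if h : b < P.card then (P.equivFin.symm ⟨b, h⟩).1 else
      (P.equivFin.symm ⟨0, hpos⟩).1, fun b hb => ?_, fun b hb b' hb' h => ?_⟩
    · simp only [hb.trans_le hk, dif_pos, Finset.coe_mem]
    · simp only [hb.trans_le hk, hb'.trans_le hk, dif_pos] at h
      simpa using P.equivFin.symm.injective (Subtype.ext h)
  -- `getVert` is constantly `t` beyond the end of a path, which produces the waiting steps. The
  -- shift by one accounts for the initial state at `t`.
  let w : ℕ → ℕ × ℕ := fun i => match i with
    | 0 => (I.t, 0)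
    | i + 1 => ((p (i / (I.l + 1))).1.getVert (i % (I.l + 1)), χ (p (i / (I.l + 1))))
  have hw1 : ∀ i, w (i + 1) =
    (((p (i / (I.l + 1))).1.getVert (i % (I.l + 1)) : ℕ), (χ (p (i / (I.l + 1))) : ℕ)) :=
    fun i => rfl
  have hdivlt : ∀ i < I.steps, i / (I.l + 1) < I.k := fun i hi =>
    Nat.div_lt_of_lt_mul (by rwa [Nat.mul_comm])
  have hlen : ∀ i < I.steps, (p (i / (I.l + 1))).1.length ≤ I.l := fun i hi =>
    hl _ (hpP _ (hdivlt i hi))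
  -- the state at the beginning of a block, and within a block
  have hw0 : ∀ i ≤ I.steps, i % (I.l + 1) = 0 → (w i).1 = I.t := by
    intro i hi h0
    cases i with
    | zero => rfl
    | succ i =>
      have hmod : i % (I.l + 1) = I.l := by
        have h₁ := Nat.div_add_mod (i + 1) (I.l + 1)
        rw [h0] at h₁
        rcases Nat.eq_zero_or_pos ((i + 1) / (I.l + 1)) with h₂ | h₂
        · rw [h₂] at h₁
          omega
        · obtain ⟨d, hd⟩ := Nat.exists_eq_succ_of_ne_zero h₂.ne'
          rw [hd] at h₁
          have : i = I.l + (I.l + 1) * d := by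
            have : (I.l + 1) * d.succ = (I.l + 1) * d + (I.l + 1) := Nat.mul_succ _ _
            omega
          rw [this, Nat.add_mul_mod_self_left, Nat.mod_eq_of_lt (by omega)]
      rw [hw1, hmod, SimpleGraph.Walk.getVert_of_length_le _ (hlen i hi)]
  have hwr : ∀ i, i % (I.l + 1) ≠ 0 → w i =
      (((p (i / (I.l + 1))).1.getVert (i % (I.l + 1) - 1) : ℕ), (χ (p (i / (I.l + 1))) : ℕ)) := by
    intro i h0
    cases i with
    | zero => simp at h0
    | succ i =>
      rw [hw1]
      have h₁ : ¬ (I.l + 1) ∣ i + 1 := fun h => h0 (Nat.mod_eq_zero_of_dvd h)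
      have h₂ : (i + 1) / (I.l + 1) = i / (I.l + 1) := by rw [Nat.succ_div, if_neg h₁, add_zero]
      have h₃ := Nat.div_add_mod (i + 1) (I.l + 1)
      have h₄ := Nat.div_add_mod i (I.l + 1)
      rw [h₂] at h₃ ⊢
      rw [show i % (I.l + 1) = (i + 1) % (I.l + 1) - 1 by omega]
  have hq : 0 < I.q := (χ (p 0)).pos
  have hrange : ∀ i, (w i).1 < I.n ∧ (w i).2 < I.q := by
    intro i
    cases i with
    | zero => exact ⟨I.t.2, hq⟩
    | succ i => exact ⟨Fin.is_lt _, Fin.is_lt _⟩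
  have hinj : ∀ b < I.k, ∀ r r', r ≤ (p b).1.length → r' ≤ (p b).1.length →
      (p b).1.getVert r = (p b).1.getVert r' → r = r' := fun b _ r r' hr hr' h =>
    (p b).2.getVert_injOn hr hr' h
  have hne_t : ∀ b r, (p b).1.getVert r ≠ I.t → r < (p b).1.length := fun b r h => by
    by_contra! h'
    exact h (SimpleGraph.Walk.getVert_of_length_le _ h')
  have hne_s : ∀ b < I.k, ∀ r, (p b).1.getVert r = I.s → r = 0 := fun b hb r h => by
    have h₁ := hne_t b r (by rw [h]; exact I.s_ne_t)
    exact hinj b hb r 0 h₁.le (Nat.zero_le _) (by simpa using h)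
  refine ⟨w, rfl, hw0 _ le_rfl (Nat.mul_mod_left _ _), (hrange _).2, fun i hi =>
    ⟨(hrange i).1, (hrange i).2, ?_⟩, fun i hi i' hi' h => ?_⟩
  · by_cases h0 : i % (I.l + 1) = 0
    · exact Or.inl ⟨h0, hw0 i hi.le h0, by simp [hw1, h0]⟩
    · refine Or.inr ⟨h0, by rw [hwr i h0, hw1], ?_, ?_⟩
      · rw [hw1]
        intro h
        exact h0 (hne_s _ (hdivlt i hi) _ (Fin.ext h))
      · obtain ⟨r, hr⟩ := Nat.exists_eq_succ_of_ne_zero h0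
        rw [hwr i h0, hw1, hr]
        simp only [Nat.succ_eq_add_one, Nat.add_sub_cancel]
        generalize hb : i / (I.l + 1) = b
        have hbk : b < I.k := hb ▸ hdivlt i hi
        by_cases hrt : (p b).1.getVert r = I.t
        · refine Or.inl ⟨by rw [hrt], ?_⟩
          have : (p b).1.length ≤ r := by
            by_contra! hlt
            have := hinj b hbk r _ hlt.le le_rfl (by simpa using hrt)
            omega
          rw [SimpleGraph.Walk.getVert_of_length_le _ (this.trans (Nat.le_succ r))]
        · refine Or.inr ⟨fun h => hrt (Fin.ext h), Fin.is_lt _, Fin.is_lt _, Fin.is_lt _, ?_⟩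
          have he : s((p b).1.getVert r, (p b).1.getVert (r + 1)) ∈ (p b).1.edges :=
            ((p b).1.mem_edges_iff_exists_getVert _).2 ⟨r, hne_t b r hrt, rfl⟩
          exact ⟨(p b).1.edges_subset_edgeSet he, hχ _ (hpP b hbk) _ he⟩
  · have hb := hdivlt i hi
    have hb' := hdivlt i' hi'
    have hcomb : i / (I.l + 1) = i' / (I.l + 1) → i % (I.l + 1) = i' % (I.l + 1) → i = i' :=
      fun h₁ h₂ => by rw [← Nat.div_add_mod i (I.l + 1), h₁, h₂, Nat.div_add_mod]
    -- each label is of one of four kinds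
    have hkind : ∀ i < I.steps, ∀ x,
        I.automaton.lab i (w i).1 (w (i + 1)).1 (w (i + 1)).2 = x →
        (i % (I.l + 1) = 0 ∧ x = I.n + χ (p (i / (I.l + 1)))) ∨
        x = I.n + I.q + i ∨
        (x = I.s ∧ i % (I.l + 1) = 1 ∧ (p (i / (I.l + 1))).1.length = 1) ∨
        (x = (p (i / (I.l + 1))).1.getVert (i % (I.l + 1)) ∧ x ≠ I.s ∧ x ≠ I.t) := by
      rintro i hi _ rfl
      by_cases h0 : i % (I.l + 1) = 0
      · exact Or.inl ⟨h0, by simp [automaton, h0, hw1]⟩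
      · have hsne : ((w (i + 1)).1 : ℕ) ≠ I.s := fun h =>
          h0 (hne_s _ (hdivlt i hi) _ (Fin.ext h))
        by_cases ht : (w (i + 1)).1 = I.t
        · by_cases hs : (w i).1 = I.s
          · refine Or.inr (Or.inr (Or.inl ⟨by simp [automaton, h0, ht, hs], ?_⟩))
            rw [hwr i h0] at hs
            have h₁ := hne_s _ (hdivlt i hi) _ (Fin.ext hs)
            have h₂ : i % (I.l + 1) = 1 := by omega
            refine ⟨h₂, ?_⟩
            rw [hw1, h₂] at ht
            have h₃ : (p (i / (I.l + 1))).1.getVert 1 = I.t := Fin.ext ht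
            have h₄ : (p (i / (I.l + 1))).1.length ≠ 0 := fun h =>
              I.s_ne_t (SimpleGraph.Walk.eq_of_length_eq_zero h)
            exact (hinj _ (hdivlt i hi) 1 _ (Nat.pos_of_ne_zero h₄) le_rfl
              (by simpa using h₃)).symm
          · exact Or.inr (Or.inl (by simp [automaton, h0, ht, hs]))
        · refine Or.inr (Or.inr (Or.inr ?_))
          have : I.automaton.lab i (w i).1 (w (i + 1)).1 (w (i + 1)).2 = (w (i + 1)).1 := by
            simp [automaton, h0, ht]
          rw [this]
          exact ⟨rfl, hsne, ht⟩
    have hvn : ∀ b r, ((p b).1.getVert r : ℕ) < I.n := fun b r => Fin.is_lt _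
    have hsn := I.s.2
    have hχn : ∀ b, (χ (p b) : ℕ) < I.q := fun b => Fin.is_lt _
    have hdis : i / (I.l + 1) ≠ i' / (I.l + 1) → _ := fun hne =>
      hd _ (hpP _ hb) _ (hpP _ hb') fun h => hne (hpinj _ hb _ hb' h)
    have h₁ := hvn (i / (I.l + 1)) (i % (I.l + 1))
    have h₂ := hvn (i' / (I.l + 1)) (i' % (I.l + 1))
    have h₃ := hχn (i / (I.l + 1))
    have h₄ := hχn (i' / (I.l + 1))
    generalize hx' : I.automaton.lab i' (w i').1 (w (i' + 1)).1 (w (i' + 1)).2 = x at h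
    -- Labels of different kinds differ: vertices lie below `n`, colors are shifted into `[n, n +
    -- q)`, time labels are at least `n + q`, and `s` is no interior vertex. Equal colors give equal
    -- blocks by `hdis`. What remains is two direct edges `st` or two interior vertices.
    rcases hkind i hi x h with ⟨h0, hx⟩ | hx | ⟨hx, hr, hlen₁⟩ | ⟨hx, hxs, hxt⟩ <;>
      rcases hkind i' hi' x hx' with ⟨h0', hy⟩ | hy | ⟨hy, hr', hlen₁'⟩ | ⟨hy, hys, hyt⟩ <;>
      try omega
    · refine hcomb (hpinj _ hb _ hb' ?_) (hr.trans hr'.symm)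
      refine Subtype.ext (SimpleGraph.Walk.ext_getVert fun j => ?_)
      cases j with
      | zero => simp
      | succ j =>
        rw [SimpleGraph.Walk.getVert_of_length_le _ (by omega),
          SimpleGraph.Walk.getVert_of_length_le _ (by omega)]
    · by_cases hbb : i / (I.l + 1) = i' / (I.l + 1)
      · refine hcomb hbb ?_
        rw [← hbb] at hy
        refine hinj _ hb _ _ (hne_t _ _ fun h => hxt ?_).le (hne_t _ _ fun h => hxt ?_).le
          (Fin.ext (hx.symm.trans hy))
        · rw [hx, h]
        · rw [hy, h]
      · have hv : (p (i / (I.l + 1))).1.getVert (i % (I.l + 1)) =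
            (p (i' / (I.l + 1))).1.getVert (i' % (I.l + 1)) := Fin.ext (hx.symm.trans hy)
        rcases (hdis hbb).1 _ (SimpleGraph.Walk.getVert_mem_support _ (i % (I.l + 1)))
          (by rw [hv]; exact SimpleGraph.Walk.getVert_mem_support _ _) with h | h
        · exact absurd (by rw [hx, h]) hxs
        · exact absurd (by rw [hx, h]) hxt

/-- The yes-instances are those for which there is a run with distinct labels. -/
theorem isYes_iff_exists_run : I.IsYes ↔
    ∃ c < I.q, ∃ xs, I.automaton.IsRun I.steps I.t c xs ∧ xs.Nodup := by
  have hnodup : ∀ w : ℕ → ℕ × ℕ, ((List.range I.steps).map fun i =>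
      I.automaton.lab i (w i).1 (w (i + 1)).1 (w (i + 1)).2).reverse.Nodup ↔
      ∀ i < I.steps, ∀ i' < I.steps,
      I.automaton.lab i (w i).1 (w (i + 1)).1 (w (i + 1)).2 =
      I.automaton.lab i' (w i').1 (w (i' + 1)).1 (w (i' + 1)).2 → i = i' := fun w => by
    rw [List.nodup_reverse, List.nodup_map_iff_inj_on List.nodup_range]
    simp only [List.mem_range]
  constructor
  · intro h
    obtain ⟨w, h0, ht, hc, hr, hl⟩ := exists_run_of_isYes h
    refine ⟨_, hc, _, (LabeledAutomaton.isRun_iff _).2 ⟨w, ?_, Prod.ext ht rfl, hr, rfl⟩, (hnodup w).2 hl⟩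
    rw [h0]
    exact ⟨rfl, rfl⟩
  · rintro ⟨c, hc, xs, hxs, hnd⟩
    obtain ⟨w, -, hw, hr, rfl⟩ := (LabeledAutomaton.isRun_iff _).1 hxs
    exact isYes_of_run w (by rw [hw]) (by rw [hw]; exact hc) hr ((hnodup w).1 hnd)

end LMaxCDDP

/-! ### The program -/

theorem RAM.Cmp.maskRank {X : Type} {Γ : RAM.Ctx X} {S a : X → ℕ} (hS : RAM.Cmp Γ S)
    (ha : RAM.Cmp Γ a) (hcap : ∀ x, Γ.Valid x → a x ≤ Γ.cap x) :
    RAM.Cmp Γ (fun x => maskRank (S x) (a x)) :=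
  RAM.Cmp.sum ha hcap (((hS.weaken _).div ((RAM.Cmp.last _ _).two_pow
    fun _ hx => (le_of_lt hx.2).trans (hcap _ hx.1))).mod (RAM.Cmp.const _ 2))

/-- Each monomial contributes a factor `a ^ i` with `i` at most the degree. With `a` a power of two
this separates the exponential part of the running time from the polynomial one. -/
theorem Polynomial.eval_le_pow_mul_eval (g : Polynomial ℕ) {x a m : ℕ} (ha : 1 ≤ a)
    (hx : x ≤ a * m) : g.eval x ≤ a ^ g.natDegree * g.eval m := by
  rw [Polynomial.eval_eq_sum_range, Polynomial.eval_eq_sum_range, Finset.mul_sum]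
  refine Finset.sum_le_sum fun i hi => ?_
  have hi' : i ≤ g.natDegree := Nat.lt_succ_iff.1 (Finset.mem_range.1 hi)
  calc g.coeff i * x ^ i ≤ g.coeff i * (a * m) ^ i := by gcongr
    _ = a ^ i * (g.coeff i * m ^ i) := by rw [mul_pow]; ring
    _ ≤ a ^ g.natDegree * (g.coeff i * m ^ i) := by gcongr

namespace LMaxCDDP

variable (I : LMaxCDDP)

/-! #### The input -/

/-- The length of the input. -/
def inputSize : ℕ := 6 + I.n * I.n + I.n * I.n * I.q

/-- The second part places the cell in the input area, which the table does not overwrite. -/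
theorem encode_getD_color {u v c : ℕ} (hu : u < I.n) (hv : v < I.n) (hc : c < I.q) :
    (I.encode.getD (6 + I.n * I.n + ((u * I.n + v) * I.q + c)) 0 ≠ 0 ↔ I.Colored u v c) ∧
      6 + I.n * I.n + ((u * I.n + v) * I.q + c) < I.inputSize := by
  have h₁ : u * I.n + v < I.n * I.n := by nlinarith
  have h₂ : (u * I.n + v) * I.q + c < I.n * I.n * I.q := by nlinarith
  refine ⟨?_, Nat.add_lt_add_left h₂ _⟩
  have hlen : ([I.n, I.q, (I.s : ℕ), (I.t : ℕ), I.l, I.k] ++ I.adjacencyList).length =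
      6 + I.n * I.n := by
    simp [adjacencyList]
    omega
  rw [encode, List.getD_append_right _ _ _ _ (by rw [hlen]; omega), hlen, Nat.add_sub_cancel_left,
    List.getD_eq_getElem _ _ (by simpa [colorList] using h₂)]
  have hq : 0 < I.q := by omega
  have hn : 0 < I.n := by omega
  have e₁ : ((u * I.n + v) * I.q + c) / I.q = u * I.n + v := by
    rw [Nat.add_comm, Nat.add_mul_div_right _ _ hq, Nat.div_eq_of_lt hc, zero_add]
  have e₂ : ((u * I.n + v) * I.q + c) % I.q = c := by
    rw [Nat.add_comm, Nat.add_mul_mod_self_right, Nat.mod_eq_of_lt hc]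
  have e₃ : (u * I.n + v) / I.n = u := by
    rw [Nat.add_comm, Nat.add_mul_div_right _ _ hn, Nat.div_eq_of_lt hv, zero_add]
  have e₄ : (u * I.n + v) % I.n = v := by
    rw [Nat.add_comm, Nat.add_mul_mod_self_right, Nat.mod_eq_of_lt hv]
  simp only [colorList, List.getElem_ofFn, finProdFinEquiv_symm_apply, Fin.divNat, Fin.modNat, e₁,
    e₂, e₃, e₄]
  simp only [ne_eq, ite_eq_right_iff, one_ne_zero, imp_false, not_not, Colored, hu, hv, hc,
    exists_true_left]
  apply Iff.of_eq
  congr 1 <;> apply Fin.ext <;> simp [e₁, e₂, e₃, e₄]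

/-! #### The table of all signed counts -/

/-- The number of bit masks. -/
def masks : ℕ := 2 ^ I.steps

/-- The position in the table of a signed count. -/
def index (j ε S T v c : ℕ) : ℕ :=
  ((((j * 2 + ε) * I.masks + S) * I.masks + T) * I.n + v) * I.q + c

/-- The number of entries of the table. -/
def tableSize : ℕ := (I.steps + 1) * 2 * I.masks * I.masks * I.n * I.q

/-- The number of transitions for the entry of the table at position `z`. -/
def layer (z : ℕ) : ℕ := z / I.q / I.n / I.masks / I.masks / 2

/-- The sign for the entry of the table at position `z`. -/
def signAt (z : ℕ) : ℕ := z / I.q / I.n / I.masks / I.masks % 2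

/-- The first bit mask for the entry of the table at position `z`. -/
def fstMask (z : ℕ) : ℕ := z / I.q / I.n / I.masks % I.masks

/-- The second bit mask for the entry of the table at position `z`. -/
def sndMask (z : ℕ) : ℕ := z / I.q / I.n % I.masks

/-- The vertex for the entry of the table at position `z`. -/
def vertexAt (z : ℕ) : ℕ := z / I.q % I.n

/-- The color for the entry of the table at position `z`. -/
def colorAt (z : ℕ) : ℕ := z % I.q

/-- The entry of the table at position `z`. -/
noncomputable def table (z : ℕ) : ℕ :=
  I.automaton.signedCount I.steps (I.layer z) (I.signAt z) (I.fstMask z) (I.sndMask z)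
    (I.vertexAt z) (I.colorAt z)

theorem masks_pos : 0 < I.masks := Nat.two_pow_pos _

/-- Positions are numbers in mixed radix; `j` is the leading digit and therefore needs no bound. -/
theorem table_index {j ε S T v c : ℕ} (hε : ε < 2) (hS : S < I.masks) (hT : T < I.masks)
    (hv : v < I.n) (hc : c < I.q) :
    I.table (I.index j ε S T v c) = I.automaton.signedCount I.steps j ε S T v c := by
  have hdiv : ∀ {x m y : ℕ}, y < m → (x * m + y) / m = x := fun {x m y} h => by
    rw [Nat.add_comm, Nat.add_mul_div_right _ _ (by omega), Nat.div_eq_of_lt h, zero_add]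
  have hmod : ∀ {x m y : ℕ}, y < m → (x * m + y) % m = y := fun {x m y} h => by
    rw [Nat.add_comm, Nat.add_mul_mod_self_right, Nat.mod_eq_of_lt h]
  simp only [table, layer, signAt, fstMask, sndMask, vertexAt, colorAt, index, hdiv hc, hmod hc, hdiv hv, hmod hv, hdiv hT, hmod hT, hdiv hS, hmod hS,
    hdiv hε, hmod hε]

/-- As the number of transitions is the leading digit, all entries of earlier layers precede layer
`j'`. Together with `mul_layer_le` this shows that the recursion only reads entries already
computed; with `j' = steps + 1` it bounds positions by the table size. -/
theorem index_lt {j j' ε S T v c : ℕ} (hj : j < j') (hε : ε < 2) (hS : S < I.masks)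
    (hT : T < I.masks) (hv : v < I.n) (hc : c < I.q) :
    I.index j ε S T v c < j' * 2 * I.masks * I.masks * I.n * I.q := by
  have h : ∀ {x y m y' : ℕ}, x < y → y' < m → x * m + y' < y * m := fun {x y m y'} h h' =>
    calc x * m + y' < (x + 1) * m := by rw [Nat.succ_mul]; omega
      _ ≤ y * m := Nat.mul_le_mul_right _ h
  exact h (h (h (h (h hj hε) hS) hT) hv) hc

theorem mul_layer_le (z : ℕ) : I.layer z * 2 * I.masks * I.masks * I.n * I.q ≤ z := by
  have h : ∀ {x m y : ℕ}, x ≤ y / m → x * m ≤ y := fun {x m y} h =>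
    (Nat.mul_le_mul_right _ h).trans (Nat.div_mul_le_self _ _)
  exact h (h (h (h (h le_rfl))))

/-- The memory when the first `z` entries of the table have been computed. -/
noncomputable def memory (z a : ℕ) : ℕ :=
  if I.inputSize ≤ a ∧ a < I.inputSize + z then I.table (a - I.inputSize) else I.encode.getD a 0

theorem memory_zero : I.memory 0 = fun a => I.encode.getD a 0 := by
  ext a
  rw [memory, if_neg (by omega)]

theorem memory_succ (z : ℕ) :
    Function.update (I.memory z) (I.inputSize + z) (I.table z) = I.memory (z + 1) := by
  ext a
  by_cases h : a = I.inputSize + z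
  · subst h
    rw [Function.update_self, memory, if_pos (by omega), Nat.add_sub_cancel_left]
  · rw [Function.update_of_ne h, memory, memory]
    congr 1
    rw [eq_iff_iff]
    omega

theorem memory_of_lt {z a : ℕ} (h : a < I.inputSize) : I.memory z a = I.encode.getD a 0 := by
  rw [memory, if_neg (by omega)]

theorem memory_index {z i : ℕ} (h : i < z) : I.memory z (I.inputSize + i) = I.table i := by
  rw [memory, if_pos (by omega), Nat.add_sub_cancel_left]

open Classical in
/-- The contribution to the entry at position `z` of the transition from `(u, d)`, when the exponents
`a` and `b` are used for its label, in terms of the memory. -/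
noncomputable def contribution (z a b u d : ℕ) : ℕ :=
  if (I.fstMask z / 2 ^ a % 2 = 1 ∧ I.sndMask z / 2 ^ b % 2 = 1) ∧
      I.automaton.rel (I.layer z - 1) u d (I.vertexAt z) (I.colorAt z) then
    I.memory z (I.inputSize + I.index (I.layer z - 1)
      ((I.signAt z + (maskRank (I.fstMask z) a + maskRank (I.sndMask z) b)) % 2)
      (I.fstMask z - 2 ^ a) (I.sndMask z - 2 ^ b) u d) *
      I.automaton.lab (I.layer z - 1) u (I.vertexAt z) (I.colorAt z) ^ (a + b)
  else 0

/-- The entry of the table at position `z`, in terms of the memory. -/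
noncomputable def nextEntry (z : ℕ) : ℕ :=
  if I.layer z = 0 then
    if (I.signAt z = 0 ∧ I.fstMask z = 0 ∧ I.sndMask z = 0) ∧ I.vertexAt z = I.t ∧ I.colorAt z = 0
    then 1 else 0
  else
    ∑ a ∈ Finset.range I.steps, ∑ b ∈ Finset.range I.steps, ∑ u ∈ Finset.range I.n,
      ∑ d ∈ Finset.range I.q, I.contribution z a b u d

theorem nextEntry_eq (z : ℕ) : I.nextEntry z = I.table z := by
  classical
  have hlayer := I.mul_layer_le z
  rw [nextEntry, table]
  obtain hj | ⟨j, hj⟩ : I.layer z = 0 ∨ ∃ j, I.layer z = j + 1 := by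
    cases I.layer z <;> simp
  · rw [if_pos hj, hj, LabeledAutomaton.signedCount]
    exact if_congr Iff.rfl rfl rfl
  · rw [if_neg (by omega), hj, LabeledAutomaton.signedCount]
    refine Finset.sum_congr rfl fun a _ => Finset.sum_congr rfl fun b _ =>
      Finset.sum_congr rfl fun u hu => Finset.sum_congr rfl fun d hd => ?_
    have hu' : u < I.n := Finset.mem_range.1 hu
    have hd' : d < I.q := Finset.mem_range.1 hd
    have hS : I.fstMask z - 2 ^ a < I.masks :=
      (Nat.sub_le _ _).trans_lt (Nat.mod_lt _ I.masks_pos)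
    have hT : I.sndMask z - 2 ^ b < I.masks :=
      (Nat.sub_le _ _).trans_lt (Nat.mod_lt _ I.masks_pos)
    rw [contribution, show I.layer z - 1 = j by omega, I.memory_index ((I.index_lt (by omega)
      (Nat.mod_lt _ two_pos) hS hT hu' hd').trans_le hlayer),
      I.table_index (Nat.mod_lt _ two_pos) hS hT hu' hd']

/-! #### The table can be computed -/

/-- The quantity in terms of which running times are measured. -/
def bound : ℕ := I.n + I.q + 2 ^ (4 * (I.l * I.k))

theorem steps_le : I.steps ≤ 2 * (I.l * I.k) := by
  have := Nat.mul_le_mul_left I.k I.one_le_l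
  rw [steps, Nat.mul_succ, Nat.mul_comm I.l]
  omega

theorem masks_le : I.masks ≤ 2 ^ (2 * (I.l * I.k)) :=
  Nat.pow_le_pow_right two_pos I.steps_le

theorem two_pow_le_bound : 2 ^ (2 * (I.l * I.k)) ≤ I.bound :=
  (Nat.pow_le_pow_right two_pos (by omega)).trans (Nat.le_add_left _ _)

theorem masks_le_bound : I.masks ≤ I.bound := I.masks_le.trans I.two_pow_le_bound

theorem n_le_bound : I.n ≤ I.bound :=
  (Nat.le_add_right _ _).trans (Nat.le_add_right _ _)

theorem q_le_bound : I.q ≤ I.bound :=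
  (Nat.le_add_left _ _).trans (Nat.le_add_right _ _)

/-- The constant `4` in `bound` comes from `2 * steps ≤ 4 * (l * k) < 2 ^ (4 * (l * k))`. This one
inequality covers the labels, at most `n + q + steps`, and the exponents `a + b`, below `2 * steps`.
-/
theorem two_mul_steps_le : 2 * I.steps + I.n + I.q ≤ I.bound := by
  have h₁ := I.steps_le
  have h₂ := Nat.lt_two_pow_self (n := 4 * (I.l * I.k))
  rw [bound]
  omega

theorem steps_pos : 0 < I.steps := Nat.mul_pos I.k_pos (Nat.succ_pos _)

theorem l_succ_le_bound : I.l + 1 ≤ I.bound := by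
  have h₁ : 1 * (I.l + 1) ≤ I.steps := Nat.mul_le_mul_right _ I.k_pos
  have h₂ := I.two_mul_steps_le
  omega

theorem tableSize_le : I.tableSize ≤ I.bound ^ 6 := by
  have h₁ := I.two_mul_steps_le
  have h₂ := I.steps_pos
  have h₃ := I.masks_le_bound
  have h₄ := I.n_le_bound
  have h₅ := I.q_le_bound
  calc I.tableSize ≤ I.bound * I.bound * I.bound * I.bound * I.bound * I.bound := by
        rw [tableSize]
        gcongr <;> omega
    _ = _ := by ring

/-- The position just past the table is admitted, because the complete table is also a situation of
`context`; hence the extra `1`. -/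
theorem layer_le {z : ℕ} (hz : z ≤ I.tableSize) : I.layer z ≤ I.steps + 1 := by
  have h : ∀ {x m y : ℕ}, x ≤ y * m → x / m ≤ y := fun {x m y} h => by
    rcases Nat.eq_zero_or_pos m with rfl | hm
    · simp
    · exact Nat.div_le_of_le_mul (by rwa [Nat.mul_comm])
  exact h (h (h (h (h hz))))

/-! ### Computability from a partly filled table -/

open RAM

/-- The situations in which an initial part of the table has been computed. -/
noncomputable def context : Ctx (LMaxCDDP × ℕ) where
  arity := 1
  Valid x := x.2 ≤ x.1.tableSize
  val _ x := x.2
  mem x := x.1.memory x.2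
  cap x := x.1.bound

theorem cmp_position : Cmp context (fun x => x.2) := Cmp.var context (i := 0) Nat.one_pos

theorem cmp_input (i : ℕ) (hi : i < 6) : Cmp context (fun x => x.1.encode.getD i 0) :=
  (Cmp.const context i).load.congr fun x _ => x.1.memory_of_lt (by rw [inputSize]; omega)

theorem cmp_n : Cmp context (fun x => x.1.n) := cmp_input 0 (by omega)

theorem cmp_q : Cmp context (fun x => x.1.q) := cmp_input 1 (by omega)

theorem cmp_s : Cmp context (fun x => (x.1.s : ℕ)) := cmp_input 2 (by omega)

theorem cmp_t : Cmp context (fun x => (x.1.t : ℕ)) := cmp_input 3 (by omega)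

theorem cmp_l_succ : Cmp context (fun x => x.1.l + 1) := (cmp_input 4 (by omega)).add (Cmp.const _ 1)

theorem cmp_k : Cmp context (fun x => x.1.k) := cmp_input 5 (by omega)

theorem cmp_steps : Cmp context (fun x => x.1.steps) :=
  cmp_k.mul cmp_l_succ fun x _ => x.1.l_succ_le_bound

theorem steps_le_cap (x : LMaxCDDP × ℕ) (_ : context.Valid x) : x.1.steps ≤ context.cap x := by
  have := x.1.two_mul_steps_le
  exact le_trans (by omega) this

theorem cmp_masks : Cmp context (fun x => x.1.masks) := cmp_steps.two_pow steps_le_cap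

theorem cmp_inputSize : Cmp context (fun x => x.1.inputSize) :=
  ((Cmp.const _ 6).add (cmp_n.mul cmp_n fun x _ => x.1.n_le_bound)).add
    ((cmp_n.mul cmp_n fun x _ => x.1.n_le_bound).mul cmp_q fun x _ => x.1.q_le_bound)

theorem cmp_tableSize : Cmp context (fun x => x.1.tableSize) :=
  (((((cmp_steps.add (Cmp.const _ 1)).mul (Cmp.const _ 2) fun x _ => by
    have h₁ := x.1.two_mul_steps_le
    have h₂ := x.1.steps_pos
    exact le_trans (by omega) h₁).mul cmp_masks fun x _ => x.1.masks_le_bound).mul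
    cmp_masks fun x _ => x.1.masks_le_bound).mul cmp_n fun x _ => x.1.n_le_bound).mul
    cmp_q fun x _ => x.1.q_le_bound

section

variable {Y : Type} {Γ : Ctx Y} {π : Y → LMaxCDDP × ℕ}

/-- The map `π` forgets the summation variables, so the same lemma serves at every depth of nested
sums, with `hπ` an iterated `Cmp.weaken`. -/
theorem cmp_index (hπ : ∀ {f : LMaxCDDP × ℕ → ℕ}, Cmp context f → Cmp Γ (fun y => f (π y)))
    (hcap : ∀ y, Γ.cap y = (π y).1.bound) {j ε S T v c : Y → ℕ} (hj : Cmp Γ j) (hε : Cmp Γ ε)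
    (hS : Cmp Γ S) (hT : Cmp Γ T) (hv : Cmp Γ v) (hc : Cmp Γ c) :
    Cmp Γ (fun y => (π y).1.index (j y) (ε y) (S y) (T y) (v y) (c y)) := by
  have hm : ∀ y, Γ.Valid y → (π y).1.masks ≤ Γ.cap y := fun y _ => hcap y ▸ (π y).1.masks_le_bound
  refine (((((((((hj.mul (Cmp.const _ 2) fun y _ => ?_).add hε).mul (hπ cmp_masks) hm).add hS).mul
    (hπ cmp_masks) hm).add hT).mul (hπ cmp_n) fun y _ => ?_).add hv).mul (hπ cmp_q)
    fun y _ => ?_).add hc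
  · have h₁ := (π y).1.two_mul_steps_le
    have h₂ := (π y).1.steps_pos
    rw [hcap]
    omega
  · exact hcap y ▸ (π y).1.n_le_bound
  · exact hcap y ▸ (π y).1.q_le_bound

theorem cmpPred_rel (hπ : ∀ {f : LMaxCDDP × ℕ → ℕ}, Cmp context f → Cmp Γ (fun y => f (π y)))
    (hmem : ∀ y, Γ.mem y = (π y).1.memory (π y).2)
    (hcap : ∀ y, Γ.cap y = (π y).1.bound) {j u d v c : Y → ℕ} (hj : Cmp Γ j)
    (hu : Cmp Γ u) (hd : Cmp Γ d) (hv : Cmp Γ v) (hc : Cmp Γ c)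
    (hlt : ∀ y, Γ.Valid y → u y < (π y).1.n ∧ v y < (π y).1.n ∧ c y < (π y).1.q) :
    CmpPred Γ (fun y => (π y).1.automaton.rel (j y) (u y) (d y) (v y) (c y)) := by
  have hn : ∀ y, Γ.Valid y → (π y).1.n ≤ Γ.cap y := fun y _ => hcap y ▸ (π y).1.n_le_bound
  have hq : ∀ y, Γ.Valid y → (π y).1.q ≤ Γ.cap y := fun y _ => hcap y ▸ (π y).1.q_le_bound
  have hcol : CmpPred Γ (fun y => (π y).1.Colored (u y) (v y) (c y)) := by
    refine ⟨_, (((Cmp.const Γ 6).add ((hπ cmp_n).mul (hπ cmp_n) hn)).add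
      (((((hu.mul (hπ cmp_n) hn).add hv).mul (hπ cmp_q) hq)).add hc)).load, fun y hy => ?_⟩
    obtain ⟨h₁, h₂, h₃⟩ := hlt y hy
    obtain ⟨h₄, h₅⟩ := (π y).1.encode_getD_color h₁ h₂ h₃
    rw [hmem, (π y).1.memory_of_lt h₅, h₄]
  have h0 := (hj.mod (hπ cmp_l_succ)).eq (Cmp.const Γ 0)
  have hut := hu.eq (hπ cmp_t)
  have hvt := hv.eq (hπ cmp_t)
  have hvs := hv.eq (hπ cmp_s)
  exact (h0.and (hut.and hvs)).or (h0.not.and ((hd.eq hc).and (hvs.not.and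
    ((hut.and hvt).or (hut.not.and hcol)))))

theorem cmp_lab (hπ : ∀ {f : LMaxCDDP × ℕ → ℕ}, Cmp context f → Cmp Γ (fun y => f (π y)))
    {j u v c : Y → ℕ} (hj : Cmp Γ j) (hu : Cmp Γ u) (hv : Cmp Γ v) (hc : Cmp Γ c) :
    Cmp Γ (fun y => (π y).1.automaton.lab (j y) (u y) (v y) (c y)) :=
  ((hj.mod (hπ cmp_l_succ)).eq (Cmp.const Γ 0)).ite ((hπ cmp_n).add hc)
    ((hv.eq (hπ cmp_t)).ite ((hu.eq (hπ cmp_s)).ite (hπ cmp_s)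
      (((hπ cmp_n).add (hπ cmp_q)).add hj)) hv)

theorem lab_le {j u v c : ℕ} (hj : j ≤ I.steps) (hv : v < I.n) (hc : c < I.q) :
    I.automaton.lab j u v c ≤ I.bound := by
  have h₁ := I.two_mul_steps_le
  have h₂ := I.s.2
  simp only [automaton]
  split_ifs <;> omega

theorem cmp_colorAt : Cmp context (fun x => x.1.colorAt x.2) := cmp_position.mod cmp_q

theorem cmp_vertexAt : Cmp context (fun x => x.1.vertexAt x.2) :=
  (cmp_position.div cmp_q).mod cmp_n

theorem cmp_sndMask : Cmp context (fun x => x.1.sndMask x.2) :=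
  ((cmp_position.div cmp_q).div cmp_n).mod cmp_masks

theorem cmp_fstMask : Cmp context (fun x => x.1.fstMask x.2) :=
  (((cmp_position.div cmp_q).div cmp_n).div cmp_masks).mod cmp_masks

theorem cmp_signAt : Cmp context (fun x => x.1.signAt x.2) :=
  ((((cmp_position.div cmp_q).div cmp_n).div cmp_masks).div cmp_masks).mod (Cmp.const _ 2)

theorem cmp_layer : Cmp context (fun x => x.1.layer x.2) :=
  ((((cmp_position.div cmp_q).div cmp_n).div cmp_masks).div cmp_masks).div (Cmp.const _ 2)

theorem cmp_contribution (hπ : ∀ {f : LMaxCDDP × ℕ → ℕ}, Cmp context f → Cmp Γ (fun y => f (π y)))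
    (hmem : ∀ y, Γ.mem y = (π y).1.memory (π y).2)
    (hcap : ∀ y, Γ.cap y = (π y).1.bound) {a b u d : Y → ℕ} (ha : Cmp Γ a)
    (hb : Cmp Γ b) (hu : Cmp Γ u) (hd : Cmp Γ d)
    (hlt : ∀ y, Γ.Valid y → (π y).2 ≤ (π y).1.tableSize ∧ a y < (π y).1.steps ∧
      b y < (π y).1.steps ∧ u y < (π y).1.n ∧ d y < (π y).1.q) :
    Cmp Γ (fun y => (π y).1.contribution (π y).2 (a y) (b y) (u y) (d y)) := by
  have hacap : ∀ y, Γ.Valid y → a y + b y ≤ Γ.cap y := fun y hy => by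
    obtain ⟨-, h₁, h₂, -⟩ := hlt y hy
    have h₃ := (π y).1.two_mul_steps_le
    rw [hcap]
    omega
  have ha' := ha.two_pow fun y hy => (Nat.le_add_right _ _).trans (hacap y hy)
  have hb' := hb.two_pow fun y hy => (Nat.le_add_left _ _).trans (hacap y hy)
  have hv : ∀ y, Γ.Valid y → (π y).1.vertexAt (π y).2 < (π y).1.n := fun y hy =>
    Nat.mod_lt _ (Nat.zero_lt_of_lt (hlt y hy).2.2.2.1)
  have hc : ∀ y, Γ.Valid y → (π y).1.colorAt (π y).2 < (π y).1.q := fun y hy =>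
    Nat.mod_lt _ (Nat.zero_lt_of_lt (hlt y hy).2.2.2.2)
  have hj := (hπ cmp_layer).sub (Cmp.const _ 1)
  have hbits := ((((hπ cmp_fstMask).div ha').mod (Cmp.const _ 2)).eq (Cmp.const _ 1)).and
    ((((hπ cmp_sndMask).div hb').mod (Cmp.const _ 2)).eq (Cmp.const _ 1))
  have hrel := cmpPred_rel hπ hmem hcap hj hu hd (hπ cmp_vertexAt) (hπ cmp_colorAt)
    fun y hy => ⟨(hlt y hy).2.2.2.1, hv y hy, hc y hy⟩
  have hrank := ((hπ cmp_fstMask).maskRank ha fun y hy =>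
    (Nat.le_add_right _ _).trans (hacap y hy)).add ((hπ cmp_sndMask).maskRank hb fun y hy =>
    (Nat.le_add_left _ _).trans (hacap y hy))
  have hindex := cmp_index hπ hcap hj (((hπ cmp_signAt).add hrank).mod (Cmp.const _ 2))
    ((hπ cmp_fstMask).sub ha') ((hπ cmp_sndMask).sub hb') hu hd
  have hload := ((hπ cmp_inputSize).add hindex).load
  simp only [hmem] at hload
  -- Table entries may far exceed `bound`; only the label and the exponent `a + b` have to be small.
  refine (hbits.and hrel).ite (hload.mul_pow (cmp_lab hπ hj hu (hπ cmp_vertexAt)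
    (hπ cmp_colorAt)) (ha.add hb) (fun y hy => ?_) hacap) (Cmp.const _ 0)
  have := (π y).1.layer_le (hlt y hy).1
  exact hcap y ▸ (π y).1.lab_le (by omega) (hv y hy) (hc y hy)

end

theorem cmp_nextEntry : Cmp context (fun x => x.1.nextEntry x.2) := by
  have hinit := ((cmp_signAt.eq (Cmp.const _ 0)).and ((cmp_fstMask.eq (Cmp.const _ 0)).and
    (cmp_sndMask.eq (Cmp.const _ 0)))).and ((cmp_vertexAt.eq cmp_t).and
    (cmp_colorAt.eq (Cmp.const _ 0)))
  have hsum₁ : Cmp (((context.ext fun x a => a < x.1.steps).ext fun y b => b < y.1.1.steps).ext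
      fun y u => u < y.1.1.1.n) (fun y => ∑ d ∈ Finset.range y.1.1.1.1.q,
        y.1.1.1.1.contribution y.1.1.1.2 y.1.1.2 y.1.2 y.2 d) :=
    Cmp.sum (g := fun y => y.1.1.1.1.1.contribution y.1.1.1.1.2 y.1.1.1.2 y.1.1.2 y.1.2 y.2)
      (((cmp_q.weaken _).weaken _).weaken _) (fun y _ => y.1.1.1.1.q_le_bound)
      (cmp_contribution (π := fun y => y.1.1.1.1)
        (fun h => (((h.weaken _).weaken _).weaken _).weaken _) (fun _ => rfl) (fun _ => rfl)
        ((((Cmp.last _ _).weaken _).weaken _).weaken _) (((Cmp.last _ _).weaken _).weaken _)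
        ((Cmp.last _ _).weaken _) (Cmp.last _ _)
        fun y hy => ⟨hy.1.1.1.1, hy.1.1.1.2, hy.1.1.2, hy.1.2, hy.2⟩)
  have hsum₂ : Cmp ((context.ext fun x a => a < x.1.steps).ext fun y b => b < y.1.1.steps)
      (fun y => ∑ u ∈ Finset.range y.1.1.1.n, ∑ d ∈ Finset.range y.1.1.1.q,
        y.1.1.1.contribution y.1.1.2 y.1.2 y.2 u d) :=
    Cmp.sum ((cmp_n.weaken _).weaken _) (fun y _ => y.1.1.1.n_le_bound) hsum₁
  have hsum₃ : Cmp (context.ext fun x a => a < x.1.steps)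
      (fun y => ∑ b ∈ Finset.range y.1.1.steps, ∑ u ∈ Finset.range y.1.1.n,
        ∑ d ∈ Finset.range y.1.1.q, y.1.1.contribution y.1.2 y.2 b u d) :=
    Cmp.sum (cmp_steps.weaken _) (fun y hy => steps_le_cap _ hy.1) hsum₂
  have hsum₄ : Cmp context (fun x => ∑ a ∈ Finset.range x.1.steps, ∑ b ∈ Finset.range x.1.steps,
      ∑ u ∈ Finset.range x.1.n, ∑ d ∈ Finset.range x.1.q, x.1.contribution x.2 a b u d) :=
    Cmp.sum cmp_steps steps_le_cap hsum₃
  exact (cmp_layer.eq (Cmp.const _ 0)).ite (hinit.ite (Cmp.const _ 1) (Cmp.const _ 0)) hsum₄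

/-- The number by which yes-instances are recognized when the table is complete. -/
noncomputable def score (x : LMaxCDDP × ℕ) : ℕ :=
  ∑ c ∈ Finset.range x.1.q,
    (x.1.memory x.2 (x.1.inputSize +
        x.1.index x.1.steps 0 (x.1.masks - 1) (x.1.masks - 1) x.1.t c) -
      x.1.memory x.2 (x.1.inputSize +
        x.1.index x.1.steps 1 (x.1.masks - 1) (x.1.masks - 1) x.1.t c))

theorem cmp_score : Cmp context score := by
  have hπ : ∀ {f : LMaxCDDP × ℕ → ℕ}, Cmp context f →
      Cmp (context.ext fun x c => c < x.1.q) (fun y => f y.1) := fun h => h.weaken _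
  have hm := (hπ cmp_masks).sub (Cmp.const _ 1)
  exact Cmp.sum cmp_q (fun x _ => x.1.q_le_bound)
    (((hπ cmp_inputSize).add (cmp_index hπ (fun _ => rfl) (hπ cmp_steps) (Cmp.const _ 0) hm hm
      (hπ cmp_t) (Cmp.last _ _))).load.sub
    ((hπ cmp_inputSize).add (cmp_index hπ (fun _ => rfl) (hπ cmp_steps) (Cmp.const _ 1) hm hm
      (hπ cmp_t) (Cmp.last _ _))).load)

/-- Truncated subtraction is nonzero exactly when the even count exceeds the odd one; the sum over
`c` leaves the color of the last path free. -/
theorem score_ne_zero_iff : score (I, I.tableSize) ≠ 0 ↔ I.IsYes := by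
  have hm : I.masks - 1 < I.masks := Nat.sub_lt I.masks_pos Nat.one_pos
  have hentry : ∀ c < I.q, ∀ ε < 2, I.memory I.tableSize (I.inputSize +
      I.index I.steps ε (I.masks - 1) (I.masks - 1) I.t c) =
      I.automaton.signedCount I.steps I.steps ε (2 ^ I.steps - 1) (2 ^ I.steps - 1) I.t c :=
    fun c hc ε hε => by
      rw [I.memory_index (show _ < I.tableSize from
          I.index_lt (Nat.lt_succ_self I.steps) hε hm hm I.t.2 hc),
        I.table_index hε hm hm I.t.2 hc, masks]
  rw [isYes_iff_exists_run, score, Ne, Finset.sum_eq_zero_iff]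
  simp only [Finset.mem_range, not_forall]
  refine ⟨fun ⟨c, hc, h⟩ => ⟨c, hc, ?_⟩, fun ⟨c, hc, h⟩ => ⟨c, hc, ?_⟩⟩
  · rw [← (I.automaton.signedCount_lt_iff I.steps I.t c).2]
    rw [hentry c hc 0 two_pos, hentry c hc 1 Nat.one_lt_two] at h
    omega
  · rw [← (I.automaton.signedCount_lt_iff I.steps I.t c).2] at h
    rw [hentry c hc 0 two_pos, hentry c hc 1 Nat.one_lt_two]
    omega

theorem cmp_answer : Cmp context (fun x => if score x ≠ 0 then 1 else 0) :=
  cmp_score.cond (Cmp.const _ 1) (Cmp.const _ 0)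

/-! ### The complete program and its running time -/

open Classical in
theorem exists_program : ∃ (p : Prog) (g : Polynomial ℕ), ∀ I : LMaxCDDP,
    Exec p (State.init I.encode) (fun σ => σ.reg 0 = I.answer) (g.eval I.bound) := by
  -- Register `0` holds the position, the only variable, and register `1` the size of the table. In
  -- each round register `2` receives the new entry and register `3` the offset of the table in
  -- memory.
  let loc : ℕ → ℕ := fun _ => 0
  obtain ⟨p₁, g₁, h₁⟩ := cmp_tableSize loc 1 fun _ _ => Nat.one_pos
  obtain ⟨p₂, g₂, h₂⟩ := cmp_nextEntry loc 2 fun _ _ => two_pos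
  obtain ⟨p₃, g₃, h₃⟩ := cmp_inputSize loc 3 fun _ _ => three_pos
  obtain ⟨p₄, g₄, h₄⟩ := cmp_answer loc 1 fun _ _ => Nat.one_pos
  refine ⟨.seq p₁ (.seq (.loop (.sub (.reg 1) (.reg 0)) (.seq p₂ (.seq p₃ (.seq
    (.store (.add (.reg 3) (.reg 0)) (.reg 2)) (.assign 0 (.add (.reg 0) (.const 1)))))))
    (.seq p₄ (.assign 0 (.reg 1)))),
    g₁ + ((Polynomial.X ^ 6 * (Polynomial.C 4 + (g₂ + (g₃ + (Polynomial.C 5 + Polynomial.C 4))))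
      + Polynomial.C 4) + (g₄ + Polynomial.C 2)), fun I => ?_⟩
  simp only [Polynomial.eval_add, Polynomial.eval_C, Polynomial.eval_mul, Polynomial.eval_pow,
    Polynomial.eval_X]
  have hrep : ∀ i ≤ I.tableSize, ∀ σ : State, σ.mem = I.memory i → σ.reg 0 = i →
      context.Rep loc (I, i) σ := fun i hi σ hm hr => ⟨hi, hm, fun _ _ => hr⟩
  have h0 := hrep 0 (Nat.zero_le _) (State.init I.encode) I.memory_zero.symm rfl
  let Inv : ℕ → State → Prop := fun i σ =>
    σ.mem = I.memory i ∧ σ.reg 0 = i ∧ σ.reg 1 = I.tableSize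
  refine (h₁ _ _ h0).seq fun σ₁ r₁ => Exec.seq (Q := Inv I.tableSize) ?_ fun σ₂ r₂ => ?_
  · refine (Exec.loop Inv (N := I.tableSize)
      (B := g₂.eval I.bound + (g₃.eval I.bound + (5 + 4))) ?_ ?_ ?_).mono (fun _ h => h) ?_
    · rintro i hi σ ⟨i₁, i₂, i₃⟩
      refine ⟨by simp only [Expr.eval, i₂, i₃]; omega, ?_⟩
      have hσ := hrep i hi.le σ i₁ i₂
      refine (h₂ _ _ hσ).seq fun τ s => ?_
      refine (h₃ _ _ (hσ.of_result (fun _ _ => two_pos) s)).seq fun τ' s' =>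
        Exec.seq (Exec.store rfl) fun τ'' s'' => Exec.assign ?_
      subst s''
      have e₀ : τ'.reg 0 = i := by rw [s'.reg 0 (by omega), s.reg 0 (by omega), i₂]
      have e₁ : τ'.reg 1 = I.tableSize := by rw [s'.reg 1 (by omega), s.reg 1 (by omega), i₃]
      have e₂ : τ'.reg 2 = I.table i := by
        rw [s'.reg 2 (by omega)]
        exact s.out.trans (I.nextEntry_eq i)
      refine ⟨?_, by simp [Expr.eval, e₀], by simp [e₁]⟩
      simp only [Expr.eval, e₀, e₂, s'.out, s'.mem, s.mem, i₁]
      exact I.memory_succ i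
    · rintro σ ⟨-, i₂, i₃⟩
      simp [Expr.eval, i₂, i₃]
    · exact ⟨r₁.mem.trans I.memory_zero.symm, by rw [r₁.reg 0 Nat.one_pos]; rfl, r₁.out⟩
    · simp only [Expr.cost]
      have := I.tableSize_le
      gcongr
  · refine (h₄ _ _ (hrep _ le_rfl σ₂ r₂.1 r₂.2.1)).seq fun σ₃ r₃ => Exec.assign ?_
    simp only [Expr.eval, Function.update_self, r₃.out, answer]
    exact if_congr I.score_ne_zero_iff rfl rfl

theorem bound_le : I.bound ≤ 2 ^ (4 * (I.l * I.k)) * (I.n + I.q + 1) := by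
  have := Nat.mul_le_mul_right (I.n + I.q) (Nat.one_le_two_pow (n := 4 * (I.l * I.k)))
  rw [bound, Nat.mul_succ]
  omega

end LMaxCDDP

/-- One program decides the problem on all instances, in time `2 ^ O(l k) * poly(n + q)`. -/
theorem mainTheorem6 :
    ∃ (p : RAM.Prog) (c : ℕ) (f : Polynomial ℕ), ∀ I : LMaxCDDP,
      ∃ T : ℕ, p.Outputs I.encode I.answer T ∧
        T ≤ 2 ^ (c * (I.l * I.k)) * f.eval (I.n + I.q) := by
  obtain ⟨p, g, h⟩ := LMaxCDDP.exists_program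
  -- By `bound_le`, `bound` is at most `2 ^ (4 * (l * k))` times `n + q + 1`; the first factor is
  -- raised to the degree of `g`, the second accounts for `X + 1`.
  refine ⟨p, 4 * g.natDegree, g.comp (Polynomial.X + 1), fun I => ?_⟩
  obtain ⟨σ, T, hrun, hout, hT⟩ := h I
  refine ⟨T, ⟨σ, hrun, hout⟩, hT.trans ((g.eval_le_pow_mul_eval Nat.one_le_two_pow
    I.bound_le).trans (le_of_eq ?_))⟩
  rw [← pow_mul, Polynomial.eval_comp, Polynomial.eval_add, Polynomial.eval_X,
    Polynomial.eval_one]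
  congr 2
  ring
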